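/- Let $(M,\langle\cdot,\cdot\rangle)$ be a smooth Riemannian manifold (without boundary) of dimension $m$, with Levi-Civita connection $\nabla$, Ricci tensor $\mathrm{Ric}$, scalar curvature $S=\mathrm{tr}\,\mathrm{Ric}$ and Laplace--Beltrami operator $\Delta=\mathrm{div}\,\nabla$. Let $X$ be a smooth vector field on $M$ and $\lambda\in\mathbb R$ a constant such that $(X,\lambda)$ is a Ricci soliton, that is, \[ \mathrm{Ric}+\tfrac12\,\mathcal L_X\langle\cdot,\cdot\rangle=\lambda\,\langle\cdot,\cdot\rangle , \] where $\mathcal L_X$ denotes the Lie derivative in the direction of $X$. Then $S$ is smooth and, at every point of $M$, \[ \tfrac12\Delta S=\tfrac12\langle\nabla S,X\rangle+\lambda S-|\mathrm{Ric}|^2 \] and \[ \tfrac12\Delta S=\tfrac12\langle\nabla S,X\rangle+\lambda S-\frac{S^2}{m}-\Big|\mathrm{Ric}-\frac Sm\langle\cdot,\cdot\rangle\Big|^2 . \] (For $m=0$ the quotients $S^2/m$ and $S/m$ are read as $0$.) -/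

import Mathlib

open Bundle FiberBundle VectorField
open scoped Manifold ContDiff Topology

noncomputable section

namespace Riem

section General

variable {E : Type*} [NormedAddCommGroup E] [NormedSpace ℝ E] [FiniteDimensional ℝ E]
  {H : Type*} [TopologicalSpace H] {I : ModelWithCorners ℝ E H}
  {M : Type*} [TopologicalSpace M] [ChartedSpace H M] [IsManifold I ∞ M]
  [RiemannianBundle (fun x : M ↦ TangentSpace I x)]
  [IsContMDiffRiemannianBundle I ∞ E (fun x : M ↦ TangentSpace I x)]

instance finiteDimensional_tangentSpace (x : M) : FiniteDimensional ℝ (TangentSpace I x) :=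
  inferInstanceAs (FiniteDimensional ℝ E)

instance isContMDiffRiemannianBundle_one :
    IsContMDiffRiemannianBundle I 1 E (fun x : M ↦ TangentSpace I x) :=
  IsContMDiffRiemannianBundle.of_le (n := ∞) (by norm_cast)

variable (I) in
/-- An orthonormal basis of the tangent space at `x`; traces and norms below are computed in it
and do not depend on its choice. -/
def onb (x : M) :
    OrthonormalBasis (Fin (Module.finrank ℝ (TangentSpace I x))) ℝ (TangentSpace I x) :=
  stdOrthonormalBasis ℝ (TangentSpace I x)

/-- The right-hand side of the Koszul formula
`2⟨∇_X Y, Z⟩ = X⟨Y,Z⟩ + Y⟨Z,X⟩ - Z⟨X,Y⟩ + ⟨[X,Y],Z⟩ - ⟨[Y,Z],X⟩ + ⟨[Z,X],Y⟩`. -/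
def koszul (Y X Z : Π x : M, TangentSpace I x) (x : M) : ℝ :=
  mvfderiv I (fun y ↦ inner ℝ (Y y) (Z y)) x (X x)
    + mvfderiv I (fun y ↦ inner ℝ (Z y) (X y)) x (Y x)
    - mvfderiv I (fun y ↦ inner ℝ (X y) (Y y)) x (Z x)
    + inner ℝ (mlieBracket I X Y x) (Z x)
    - inner ℝ (mlieBracket I Y Z x) (X x)
    + inner ℝ (mlieBracket I Z X x) (Y x)

theorem mdiff_inner {Y Z : Π x : M, TangentSpace I x} {x : M}
    (hY : MDiffAt (T% Y) x) (hZ : MDiffAt (T% Z) x) :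
    MDiffAt (fun y ↦ inner ℝ (Y y) (Z y)) x :=
  MDifferentiableAt.inner_bundle (F := E) (E := fun x : M ↦ TangentSpace I x) (b := id) hY hZ

theorem koszul_tensorial_left {Y Z : Π x : M, TangentSpace I x} {x : M}
    (hY : MDiffAt (T% Y) x) (hZ : MDiffAt (T% Z) x) :
    TensorialAt I E (fun X ↦ koszul Y X Z x) x where
  smul {f X} hf hX := by
    simp [koszul, inner_smul_left, inner_smul_right, inner_add_left,
      mvfderiv_fun_mul hf (mdiff_inner hX hY), mvfderiv_fun_mul hf (mdiff_inner hZ hX),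
      mlieBracket_smul_left hf hX, mlieBracket_smul_right hf hX, real_inner_comm (X x) (Z x)]
    ring
  add {X X'} hX hX' := by
    simp [koszul, inner_add_left, inner_add_right,
      mvfderiv_fun_add (mdiff_inner hX hY) (mdiff_inner hX' hY),
      mvfderiv_fun_add (mdiff_inner hZ hX) (mdiff_inner hZ hX'),
      mlieBracket_add_left hX hX', mlieBracket_add_right hX hX']
    ring

theorem koszul_tensorial_right {Y X : Π x : M, TangentSpace I x} {x : M}
    (hY : MDiffAt (T% Y) x) (hX : MDiffAt (T% X) x) :
    TensorialAt I E (fun Z ↦ koszul Y X Z x) x where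
  smul {f Z} hf hZ := by
    simp [koszul, inner_smul_left, inner_smul_right, inner_add_left,
      mvfderiv_fun_mul hf (mdiff_inner hY hZ), mvfderiv_fun_mul hf (mdiff_inner hZ hX),
      mlieBracket_smul_left hf hZ, mlieBracket_smul_right hf hZ, real_inner_comm (Z x) (Y x)]
    ring
  add {Z Z'} hZ hZ' := by
    simp [koszul, inner_add_left, inner_add_right,
      mvfderiv_fun_add (mdiff_inner hY hZ) (mdiff_inner hY hZ'),
      mvfderiv_fun_add (mdiff_inner hZ hX) (mdiff_inner hZ' hX),
      mlieBracket_add_left hZ hZ', mlieBracket_add_right hZ hZ']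
    ring

theorem koszul_add {Y Y' X Z : Π x : M, TangentSpace I x} {x : M}
    (hY : MDiffAt (T% Y) x) (hY' : MDiffAt (T% Y') x) (hX : MDiffAt (T% X) x)
    (hZ : MDiffAt (T% Z) x) :
    koszul (Y + Y') X Z x = koszul Y X Z x + koszul Y' X Z x := by
  simp [koszul, inner_add_left, inner_add_right,
    mvfderiv_fun_add (mdiff_inner hY hZ) (mdiff_inner hY' hZ),
    mvfderiv_fun_add (mdiff_inner hX hY) (mdiff_inner hX hY'),
    mlieBracket_add_left hY hY', mlieBracket_add_right hY hY']
  ring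

theorem koszul_leibniz {Y X Z : Π x : M, TangentSpace I x} {f : M → ℝ} {x : M}
    (hY : MDiffAt (T% Y) x) (hf : MDiffAt f x) (hX : MDiffAt (T% X) x)
    (hZ : MDiffAt (T% Z) x) :
    koszul (f • Y) X Z x
      = f x * koszul Y X Z x + 2 * (mvfderiv I f x (X x) * inner ℝ (Y x) (Z x)) := by
  simp [koszul, inner_smul_left, inner_smul_right, inner_add_left,
    mvfderiv_fun_mul hf (mdiff_inner hY hZ), mvfderiv_fun_mul hf (mdiff_inner hX hY),
    mlieBracket_smul_left hf hY, mlieBracket_smul_right hf hY, real_inner_comm (Y x) (X x)]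
  ring

open scoped Classical in
/-- The covariant derivative `v ↦ ∇_v Y` at `x`: the endomorphism of the tangent space whose inner
products are given by the Koszul formula (and `0` if `Y` is not differentiable at `x`). -/
def leviCivitaFun (Y : Π x : M, TangentSpace I x) (x : M) :
    TangentSpace I x →L[ℝ] TangentSpace I x :=
  if hY : MDiffAt (T% Y) x then
    (1 / 2 : ℝ) • ∑ i, ((TensorialAt.mkHom₂ (fun X Z ↦ koszul Y X Z x) x
      (fun _ hZ ↦ koszul_tensorial_left hY hZ)
      (fun _ hX ↦ koszul_tensorial_right hY hX)).flip (onb I x i)).smulRight (onb I x i)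
  else 0

theorem two_mul_inner_leviCivitaFun {Y X Z : Π x : M, TangentSpace I x} {x : M}
    (hY : MDiffAt (T% Y) x) (hX : MDiffAt (T% X) x) (hZ : MDiffAt (T% Z) x) :
    2 * inner ℝ (leviCivitaFun Y x (X x)) (Z x) = koszul Y X Z x := by
  rw [leviCivitaFun, dif_pos hY]
  set B := TensorialAt.mkHom₂ (fun X Z ↦ koszul Y X Z x) x
      (fun _ hZ ↦ koszul_tensorial_left hY hZ)
      (fun _ hX ↦ koszul_tensorial_right hY hX) with hB
  have h1 : B (X x) (Z x) = koszul Y X Z x := TensorialAt.mkHom₂_apply _ _ hX hZ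
  rw [← h1]
  conv_rhs => rw [← (onb I x).sum_repr' (Z x)]
  simp [sum_inner, inner_smul_left, Finset.mul_sum, mul_comm]

theorem isCovariantDerivativeOn_leviCivitaFun :
    IsCovariantDerivativeOn E
      (leviCivitaFun : (Π x : M, TangentSpace I x) → _) Set.univ where
  add {Y Y' x} hY hY' _ := by
    ext v
    refine ext_inner_right ℝ fun w ↦ ?_
    have hv := mdifferentiableAt_extend I E v
    have hw := mdifferentiableAt_extend I E w
    have h1 := two_mul_inner_leviCivitaFun hY hv hw
    have h2 := two_mul_inner_leviCivitaFun hY' hv hw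
    have h3 := two_mul_inner_leviCivitaFun (mdifferentiableAt_add_section hY hY') hv hw
    rw [koszul_add hY hY' hv hw] at h3
    simp only [extend_apply_self] at h1 h2 h3
    simp only [add_apply, inner_add_left]
    linarith
  leibniz {Y f x} hY hf _ := by
    ext v
    refine ext_inner_right ℝ fun w ↦ ?_
    have hv := mdifferentiableAt_extend I E v
    have hw := mdifferentiableAt_extend I E w
    have h1 := two_mul_inner_leviCivitaFun hY hv hw
    have h3 := two_mul_inner_leviCivitaFun (hf.smul_section hY) hv hw
    rw [koszul_leibniz hY hf hv hw] at h3
    simp only [extend_apply_self] at h1 h3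
    simp [inner_add_left, inner_smul_left]
    linear_combination (1 / 2) * h3 - (f x / 2) * h1

variable (I M) in
/-- The Levi-Civita connection; `leviCivita I M Y x v` is `∇_v Y` at `x`. -/
def leviCivita : CovariantDerivative I E (fun x : M ↦ TangentSpace I x) where
  toFun := leviCivitaFun
  isCovariantDerivativeOnUniv := isCovariantDerivativeOn_leviCivitaFun

theorem leviCivita_torsion : (leviCivita I M).torsion = 0 := by
  rw [CovariantDerivative.torsion_eq_zero_iff]
  intro X Y x hX hY
  refine ext_inner_right ℝ fun w ↦ ?_
  have hw := mdifferentiableAt_extend I E w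
  have h1 := two_mul_inner_leviCivitaFun hY hX hw
  have h2 := two_mul_inner_leviCivitaFun hX hY hw
  change inner ℝ (leviCivitaFun Y x (X x) - leviCivitaFun X x (Y x)) w = _
  simp only [koszul, extend_apply_self, mlieBracket_swap_apply (V := Y) (W := X),
    mlieBracket_swap_apply (V := extend E w) (W := X),
    mlieBracket_swap_apply (V := extend E w) (W := Y), inner_neg_left] at h1 h2
  simp only [real_inner_comm (Y _) (X _), real_inner_comm (extend E w _) (X _),
    real_inner_comm (extend E w _) (Y _)] at h1 h2
  rw [inner_sub_left]
  linarith

theorem leviCivita_metric {X Y Z : Π x : M, TangentSpace I x} {x : M}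
    (hX : MDiffAt (T% X) x) (hY : MDiffAt (T% Y) x) (hZ : MDiffAt (T% Z) x) :
    mvfderiv I (fun y ↦ inner ℝ (Y y) (Z y)) x (X x)
      = inner ℝ (leviCivita I M Y x (X x)) (Z x) + inner ℝ (Y x) (leviCivita I M Z x (X x)) := by
  have h1 := two_mul_inner_leviCivitaFun hY hX hZ
  have h2 := two_mul_inner_leviCivitaFun hZ hX hY
  change _ = inner ℝ (leviCivitaFun Y x (X x)) (Z x) + inner ℝ (Y x) (leviCivitaFun Z x (X x))
  simp only [koszul, mlieBracket_swap_apply (V := Y) (W := X),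
    mlieBracket_swap_apply (V := Z) (W := X),
    mlieBracket_swap_apply (V := Z) (W := Y), inner_neg_left] at h1 h2
  simp only [real_inner_comm (Y _) (X _), real_inner_comm (Z _) (X _),
    real_inner_comm (Z _) (Y _)] at h1 h2
  rw [real_inner_comm _ (Y x)]
  simp only [real_inner_comm (Z _) (Y _)]
  linarith

/-- `R(U,V)W = ∇_U ∇_V W - ∇_V ∇_U W - ∇_{[U,V]} W`. -/
def curvature (U V W : Π x : M, TangentSpace I x) (x : M) : TangentSpace I x :=
  leviCivita I M (fun y ↦ leviCivita I M W y (V y)) x (U x)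
    - leviCivita I M (fun y ↦ leviCivita I M W y (U y)) x (V x)
    - leviCivita I M W x (mlieBracket I U V x)

/-- The Riemann tensor `R(u,v)w` on tangent vectors at `x`, computed by extending them to vector
fields that are smooth near `x`. -/
def riemannTensor (x : M) (u v w : TangentSpace I x) : TangentSpace I x :=
  curvature (extend E u) (extend E v) (extend E w) x

/-- `Ric(u,v)` is the trace of `e ↦ R(e,u)v`. -/
def ricci (x : M) (u v : TangentSpace I x) : ℝ :=
  ∑ i, inner ℝ (riemannTensor x (onb I x i) u v) (onb I x i)

variable (I) in
/-- Scalar curvature. -/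
def scalarCurvature (x : M) : ℝ := ∑ i, ricci x (onb I x i) (onb I x i)

/-- The squared norm `|B|²` of a bilinear form on the tangent space at `x`. -/
def normSq {x : M} (B : TangentSpace I x → TangentSpace I x → ℝ) : ℝ :=
  ∑ i, ∑ j, B (onb I x i) (onb I x j) ^ 2

variable (I) in
/-- The gradient of `f`. -/
def gradient (f : M → ℝ) (x : M) : TangentSpace I x :=
  ∑ i, mvfderiv I f x (onb I x i) • onb I x i

/-- The divergence of a vector field. -/
def divergence (Y : Π x : M, TangentSpace I x) (x : M) : ℝ :=
  ∑ i, inner ℝ (leviCivita I M Y x (onb I x i)) (onb I x i)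

variable (I) in
/-- The Laplace-Beltrami operator `Δf = div ∇f`. -/
def laplacian (f : M → ℝ) (x : M) : ℝ := divergence (gradient I f) x

/-- The Lie derivative of the metric,
`(L_X g)(Y,Z) = X⟨Y,Z⟩ - ⟨[X,Y],Z⟩ - ⟨Y,[X,Z]⟩`, on tangent vectors `u`, `v` at `x` extended to
vector fields that are smooth near `x`. -/
def lieDerivMetric (X : Π x : M, TangentSpace I x) (x : M) (u v : TangentSpace I x) : ℝ :=
  mvfderiv I (fun y ↦ inner ℝ (extend E u y) (extend E v y)) x (X x)
    - inner ℝ (mlieBracket I X (extend E u) x) v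
    - inner ℝ u (mlieBracket I X (extend E v) x)

/-- `(X, lam)` is a Ricci soliton: `X` is a smooth vector field and `Ric + ½ L_X g = lam g`. -/
structure IsRicciSoliton (X : Π x : M, TangentSpace I x) (lam : ℝ) : Prop where
  contMDiff : ContMDiff I I.tangent ∞ (T% X)
  eq : ∀ (x : M) (u v : TangentSpace I x),
    ricci x u v + 1 / 2 * lieDerivMetric X x u v = lam * inner ℝ u v

end General

end Riem

end

/-!
The identity is local and purely formal, so it is proved over the ring of functions and the Lie
ring of vector fields that are smooth on an open set carrying an orthonormal frame, where covariant
derivatives, curvature and traces are algebraic operations. Tracing the soliton equation gives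
`d (div X) = -d S`. Taking its divergence, and using the contracted Bianchi identity
`dS = 2 div Ric`, gives `div (∇X) = -Ric X`, while commuting derivatives gives
`div ((∇X)ᵗ) = Ric X + d (div X)`. The double divergence of a bilinear form does not change under
transposition; for `∇X` this says `ΔS = 2 div (Ric X)`, and expanding the right-hand side with the
contracted Bianchi and soliton equations gives the first formula. The second one follows from the
orthogonality of the trace and traceless parts of `Ric`.
-/

namespace Riem

section Frames

variable {A L ι : Type*} [CommRing A] [AddCommGroup L] [Module A L] [Fintype ι] (e : ι → L)

/-- The trace `∑ i, T(e i, e i)` of a bilinear form in a frame. -/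
def frameTrace : (L →ₗ[A] L →ₗ[A] A) →ₗ[A] A :=
  ∑ i, LinearMap.applyₗ (e i) ∘ₗ LinearMap.applyₗ (e i)

theorem frameTrace_apply (T : L →ₗ[A] L →ₗ[A] A) : frameTrace e T = ∑ i, T (e i) (e i) := by
  simp [frameTrace]

theorem frameTrace_flip (T : L →ₗ[A] L →ₗ[A] A) : frameTrace e T.flip = frameTrace e T := by
  simp [frameTrace_apply]

/-- The full contraction `∑ i j, T(e i, e j) T'(e i, e j)` of two bilinear forms in a frame. -/
def frameContract (T T' : L →ₗ[A] L →ₗ[A] A) : A := ∑ i, ∑ j, T (e i) (e j) * T' (e i) (e j)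

theorem frameContract_flip (T T' : L →ₗ[A] L →ₗ[A] A) :
    frameContract e T.flip T'.flip = frameContract e T T' :=
  Finset.sum_comm

theorem frameContract_comm (T T' : L →ₗ[A] L →ₗ[A] A) :
    frameContract e T T' = frameContract e T' T := by
  simp only [frameContract, mul_comm]

theorem frameContract_add_right (T T₁ T₂ : L →ₗ[A] L →ₗ[A] A) :
    frameContract e T (T₁ + T₂) = frameContract e T T₁ + frameContract e T T₂ := by
  simp [frameContract, mul_add, Finset.sum_add_distrib]

theorem frameContract_smul_right (c : A) (T T' : L →ₗ[A] L →ₗ[A] A) :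
    frameContract e T (c • T') = c * frameContract e T T' := by
  simp [frameContract, Finset.mul_sum, mul_left_comm]

/-- `e` is a Parseval frame for `g`: every `V` is the sum of the `g(V, e i) e i`. Orthonormal
frames of vector fields are the example of interest. -/
def IsParsevalFrame (g : L →ₗ[A] L →ₗ[A] A) : Prop := ∀ V, ∑ i, g V (e i) • e i = V

variable {e} {g : L →ₗ[A] L →ₗ[A] A}

theorem IsParsevalFrame.sum_apply (he : IsParsevalFrame e g) (α : L →ₗ[A] A) (V : L) :
    ∑ i, g V (e i) * α (e i) = α V := by
  conv_rhs => rw [← he V]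
  simp

theorem IsParsevalFrame.frameContract_left (he : IsParsevalFrame e g) (T : L →ₗ[A] L →ₗ[A] A) :
    frameContract e g T = frameTrace e T := by
  simp only [frameContract, frameTrace_apply, he.sum_apply]

theorem IsParsevalFrame.apply_sum_smul (he : IsParsevalFrame e g) (hg : ∀ U V, g U V = g V U)
    (α : L →ₗ[A] A) : g (∑ i, α (e i) • e i) = α := by
  ext V
  rw [hg]
  simpa only [map_sum, map_smul, smul_eq_mul, mul_comm] using he.sum_apply α V

variable {κ : Type*} [Fintype κ] {e' : κ → L}

theorem IsParsevalFrame.frameTrace_eq (he : IsParsevalFrame e g) (he' : IsParsevalFrame e' g)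
    (hg : ∀ U V, g U V = g V U) (T : L →ₗ[A] L →ₗ[A] A) : frameTrace e T = frameTrace e' T := by
  have expand (i : ι) : T (e i) (e i) = ∑ k, g (e' k) (e i) * T (e' k) (e i) := by
    simpa only [hg (e i), LinearMap.flip_apply] using (he'.sum_apply (T.flip (e i)) (e i)).symm
  simp only [frameTrace_apply, expand]
  rw [Finset.sum_comm]
  simp only [he.sum_apply]

theorem IsParsevalFrame.frameContract_eq (he : IsParsevalFrame e g) (he' : IsParsevalFrame e' g)
    (hg : ∀ U V, g U V = g V U) (T T' : L →ₗ[A] L →ₗ[A] A) :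
    frameContract e T T' = frameContract e' T T' := by
  have sum_eq (φ ψ : L →ₗ[A] A) : ∑ i, φ (e i) * ψ (e i) = ∑ k, φ (e' k) * ψ (e' k) := by
    simpa only [frameTrace_apply, LinearMap.compl₁₂_apply, LinearMap.mul_apply'] using
      he.frameTrace_eq he' hg ((LinearMap.mul A A).compl₁₂ φ ψ)
  simp only [frameContract, sum_eq]
  rw [Finset.sum_comm]
  simp only [← LinearMap.flip_apply T, ← LinearMap.flip_apply T', sum_eq]
  exact Finset.sum_comm

theorem IsParsevalFrame.rotate [DecidableEq ι] (he : IsParsevalFrame e g) {c : κ → ι → A}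
    (hc : ∀ j k, ∑ i, c i j * c i k = if j = k then 1 else 0) :
    IsParsevalFrame (fun i ↦ ∑ j, c i j • e j) g := fun V ↦ by
  have expand (i : κ) : g V (∑ j, c i j • e j) • ∑ k, c i k • e k
      = ∑ k, ∑ j, (c i j * c i k) • g V (e j) • e k := by
    simp only [map_sum, map_smul, Finset.smul_sum, Finset.sum_smul]
    refine Finset.sum_congr rfl fun k _ ↦ Finset.sum_congr rfl fun j _ ↦ ?_
    module
  calc ∑ i, g V (∑ j, c i j • e j) • ∑ k, c i k • e k
      = ∑ k, ∑ j, (∑ i, c i j * c i k) • g V (e j) • e k := by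
        simp only [expand, Finset.sum_smul]
        rw [Finset.sum_comm]
        exact Finset.sum_congr rfl fun k _ ↦ Finset.sum_comm
    _ = ∑ k, g V (e k) • e k := by simp [hc]
    _ = V := he V

theorem IsParsevalFrame.sum_smul_eq {e' : κ → L} (he : IsParsevalFrame e g)
    (he' : IsParsevalFrame e' g) (hg : ∀ U V, g U V = g V U) (α : L →ₗ[A] A) :
    ∑ i, α (e i) • e i = ∑ k, α (e' k) • e' k := by
  simpa only [he.apply_sum_smul hg] using (he' (∑ i, α (e i) • e i)).symm

end Frames

section Differential

variable {A L : Type*} [CommRing A] [LieRing L] [Module A L] [LieRingModule L A]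
  [LieRinehartRing A L]

/-- The differential `V ↦ V f` of a function, as a one-form. -/
def differential : A →+ L →ₗ[A] A where
  toFun f := { toFun V := ⁅V, f⁆, map_add' := by simp, map_smul' := by simp }
  map_zero' := by ext; simp
  map_add' f f' := by ext; simp

theorem differential_apply (f : A) (V : L) : differential f V = ⁅V, f⁆ := rfl

end Differential

/-- A Lie–Rinehart ring `(A, L)` with a metric and its Levi-Civita connection `conn U V = ∇_U V`:
the functions and vector fields on an open subset of a Riemannian manifold, stripped of the
underlying space. The metric need not be nondegenerate, so the Koszul formula does not determine
the connection, which is therefore part of the data. -/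
structure LeviCivitaStructure (A L : Type*) [CommRing A] [LieRing L] [Module A L]
    [LieRingModule L A] where
  metric : L →ₗ[A] L →ₗ[A] A
  conn : L →ₗ[A] L →+ L
  metric_comm : ∀ U V, metric U V = metric V U
  leibniz : ∀ U V (f : A), conn U (f • V) = f • conn U V + ⁅U, f⁆ • V
  torsion_free : ∀ U V, conn U V - conn V U = ⁅U, V⁆
  lie_metric : ∀ U V W, ⁅U, metric V W⁆ = metric (conn U V) W + metric V (conn U W)

namespace LeviCivitaStructure

variable {A L : Type*} [CommRing A] [LieRing L] [Module A L] [LieRingModule L A]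
  (G : LeviCivitaStructure A L)

theorem conn_lie (U V W : L) : G.conn ⁅U, V⁆ W = G.conn (G.conn U V) W - G.conn (G.conn V U) W := by
  rw [← G.torsion_free, map_sub, AddMonoidHom.sub_apply]

/-- The curvature operator `W ↦ R(U,V)W`. -/
def curvatureEnd (U V : L) : L →ₗ[A] L where
  toFun W := G.conn U (G.conn V W) - G.conn V (G.conn U W) - G.conn ⁅U, V⁆ W
  map_add' W W' := by simp only [map_add]; abel
  map_smul' f W := by
    simp only [leibniz, map_add, RingHom.id_apply, lie_lie, sub_smul]
    module

/-- The Riemann tensor `R(U,V)W = ∇_U ∇_V W - ∇_V ∇_U W - ∇_{[U,V]} W`. -/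
def curvature : L →ₗ[A] L →ₗ[A] L →ₗ[A] L :=
  LinearMap.mk₂ A G.curvatureEnd
    (fun U U' V ↦ by
      ext W
      simp only [curvatureEnd, LinearMap.coe_mk, AddHom.coe_mk, LinearMap.add_apply, map_add,
        add_lie, AddMonoidHom.add_apply]
      abel)
    (fun f U V ↦ by
      ext W
      simp only [curvatureEnd, LinearMap.coe_mk, AddHom.coe_mk, LinearMap.smul_apply, map_smul,
        conn_lie, AddMonoidHom.smul_apply, leibniz, map_add, AddMonoidHom.add_apply]
      module)
    (fun U V V' ↦ by
      ext W
      simp only [curvatureEnd, LinearMap.coe_mk, AddHom.coe_mk, LinearMap.add_apply, map_add,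
        lie_add, AddMonoidHom.add_apply]
      abel)
    (fun f U V ↦ by
      ext W
      simp only [curvatureEnd, LinearMap.coe_mk, AddHom.coe_mk, LinearMap.smul_apply, map_smul,
        conn_lie, AddMonoidHom.smul_apply, leibniz, map_add, AddMonoidHom.add_apply]
      module)

theorem curvature_apply (U V W : L) : G.curvature U V W =
    G.conn U (G.conn V W) - G.conn V (G.conn U W) - G.conn ⁅U, V⁆ W := rfl

theorem curvature_swap (U V W : L) : G.curvature U V W = -G.curvature V U W := by
  rw [curvature_apply, curvature_apply, ← lie_skew, map_neg, AddMonoidHom.neg_apply]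
  abel

theorem bianchi_first (U V W : L) :
    G.curvature U V W + G.curvature V W U + G.curvature W U V = 0 := by
  rw [← lie_jacobi U V W]
  simp only [curvature_apply, ← G.torsion_free, map_sub, AddMonoidHom.sub_apply]
  abel

theorem metric_curvature_skew (U V W Z : L) :
    G.metric (G.curvature U V W) Z = -G.metric (G.curvature U V Z) W := by
  have h := lie_lie U V (G.metric W Z)
  simp only [lie_metric, lie_add] at h
  rw [G.metric_comm (G.curvature U V Z) W]
  simp only [curvature_apply, map_sub, LinearMap.sub_apply]
  linear_combination -h

theorem metric_curvature_pair [IsAddTorsionFree A] (U V W Z : L) :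
    G.metric (G.curvature U V W) Z = G.metric (G.curvature W Z U) V := by
  have bianchi (U V W Z : L) : G.metric (G.curvature U V W) Z + G.metric (G.curvature V W U) Z
      + G.metric (G.curvature W U V) Z = 0 := by
    rw [← LinearMap.add_apply, ← map_add, ← LinearMap.add_apply, ← map_add, bianchi_first,
      map_zero, LinearMap.zero_apply]
  have swap (U V W Z : L) : G.metric (G.curvature U V W) Z = -G.metric (G.curvature V U W) Z := by
    rw [curvature_swap, map_neg, LinearMap.neg_apply]
  have skew := G.metric_curvature_skew
  refine nsmul_right_injective two_ne_zero ?_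
  simp only [nsmul_eq_mul, Nat.cast_ofNat]
  -- the four Bianchi identities sit on the faces of Milnor's octahedron
  linear_combination bianchi W U V Z - bianchi U V Z W - bianchi V Z W U
    + bianchi Z W U V + skew U V W Z + skew V Z W U - skew W U V Z + swap Z U V W - skew U Z V W
    + skew Z W U V - 2 * swap Z W U V - swap V W U Z + skew W V U Z

/-- The covariant derivative `(∇_U R)(V,W)Z` of the Riemann tensor. -/
def covCurvature (U V W Z : L) : L :=
  G.conn U (G.curvature V W Z) - G.curvature (G.conn U V) W Z - G.curvature V (G.conn U W) Z
    - G.curvature V W (G.conn U Z)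

theorem covCurvature_swap (U V W Z : L) : G.covCurvature U V W Z = -G.covCurvature U W V Z := by
  simp only [covCurvature, G.curvature_swap V W, G.curvature_swap (G.conn U V) W,
    G.curvature_swap V (G.conn U W), map_neg]
  abel

theorem metric_covCurvature (U V W Z Y : L) : G.metric (G.covCurvature U V W Z) Y =
    ⁅U, G.metric (G.curvature V W Z) Y⁆ - G.metric (G.curvature (G.conn U V) W Z) Y
      - G.metric (G.curvature V (G.conn U W) Z) Y - G.metric (G.curvature V W (G.conn U Z)) Y
      - G.metric (G.curvature V W Z) (G.conn U Y) := by
  simp only [covCurvature, lie_metric, map_sub, LinearMap.sub_apply]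
  ring

theorem metric_covCurvature_skew (U V W Z Y : L) :
    G.metric (G.covCurvature U V W Z) Y = -G.metric (G.covCurvature U V W Y) Z := by
  simp only [metric_covCurvature]
  rw [G.metric_curvature_skew V W Z, G.metric_curvature_skew (G.conn U V) W Z,
    G.metric_curvature_skew V (G.conn U W) Z, G.metric_curvature_skew V W (G.conn U Z),
    G.metric_curvature_skew V W Z, lie_neg]
  ring

theorem bianchi_second (U V W Z : L) :
    G.covCurvature U V W Z + G.covCurvature V W U Z + G.covCurvature W U V Z = 0 := by
  have h := congrArg (fun Y ↦ -G.conn Y Z) (lie_jacobi U V W)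
  simp only [← G.torsion_free, map_sub, map_add, AddMonoidHom.sub_apply, AddMonoidHom.add_apply,
    map_zero, AddMonoidHom.zero_apply, neg_zero] at h
  rw [← h]
  simp only [covCurvature, curvature_apply, ← G.torsion_free, map_sub, AddMonoidHom.sub_apply]
  abel

section Forms

variable [LieRinehartRing A L]

/-- The covariant derivative `(∇_U α)(V) = U (α V) - α (∇_U V)` of a one-form. For the one-form
`metric X` this is the bilinear form `(U, V) ↦ ⟨∇_U X, V⟩`. -/
def covOneForm : (L →ₗ[A] A) →+ L →ₗ[A] L →ₗ[A] A where
  toFun α := LinearMap.mk₂ A (fun U V ↦ ⁅U, α V⁆ - α (G.conn U V))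
    (fun _ _ _ ↦ by simp only [add_lie, map_add, AddMonoidHom.add_apply]; ring)
    (fun _ _ _ ↦ by
      simp only [LieRinehartRing.lie_smul_eq_mul, map_smul, AddMonoidHom.smul_apply, smul_eq_mul]
      ring)
    (fun _ _ _ ↦ by simp only [lie_add, map_add]; ring)
    (fun _ _ _ ↦ by
      simp only [map_smul, smul_eq_mul, LieRinehartRing.leibniz_mul_right, leibniz, map_add]
      ring)
  map_zero' := by ext; simp
  map_add' α α' := by ext; simp; ring

theorem covOneForm_apply (α : L →ₗ[A] A) (U V : L) :
    G.covOneForm α U V = ⁅U, α V⁆ - α (G.conn U V) := rfl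

theorem covOneForm_metric (X U V : L) :
    G.covOneForm (G.metric X) U V = G.metric (G.conn U X) V := by
  rw [covOneForm_apply, lie_metric, add_sub_cancel_right]

theorem covOneForm_smul (f : A) (α : L →ₗ[A] A) (U : L) :
    G.covOneForm (f • α) U = f • G.covOneForm α U + ⁅U, f⁆ • α := by
  ext V
  simp [covOneForm_apply]
  ring

/-- The covariant derivative `(∇_U T)(V, W) = U (T(V, W)) - T(∇_U V, W) - T(V, ∇_U W)` of a
bilinear form. -/
def covBilin : (L →ₗ[A] L →ₗ[A] A) →+ L →ₗ[A] L →ₗ[A] L →ₗ[A] A where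
  toFun T := LinearMap.mk₂ A (fun U V ↦ G.covOneForm (T V) U - T (G.conn U V))
    (fun _ _ _ ↦ by simp only [map_add, AddMonoidHom.add_apply]; abel)
    (fun _ _ _ ↦ by simp only [map_smul, AddMonoidHom.smul_apply, smul_sub])
    (fun _ _ _ ↦ by simp only [map_add, LinearMap.add_apply]; abel)
    (fun _ _ _ ↦ by simp only [map_smul, leibniz, map_add, covOneForm_smul]; module)
  map_zero' := by ext; simp
  map_add' T T' := by ext; simp; ring

theorem covBilin_apply (T : L →ₗ[A] L →ₗ[A] A) (U V W : L) :
    G.covBilin T U V W = ⁅U, T V W⁆ - T (G.conn U V) W - T V (G.conn U W) := by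
  change ⁅U, T V W⁆ - T V (G.conn U W) - T (G.conn U V) W = _
  ring

theorem covBilin_flip (T : L →ₗ[A] L →ₗ[A] A) (U : L) :
    G.covBilin T.flip U = (G.covBilin T U).flip := by
  ext V W
  simp only [covBilin_apply, LinearMap.flip_apply]
  ring

theorem covBilin_metric : G.covBilin G.metric = 0 := by
  ext U V W
  simp [covBilin_apply, lie_metric]

theorem covBilin_smul_of_lie_eq_zero {c : A} (hc : ∀ U : L, ⁅U, c⁆ = 0)
    (T : L →ₗ[A] L →ₗ[A] A) : G.covBilin (c • T) = c • G.covBilin T := by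
  ext U V W
  simp [covBilin_apply, hc]
  ring

/-- The second covariant derivative `∇²_{U,V} T` of a bilinear form. -/
def secondCovBilin (T : L →ₗ[A] L →ₗ[A] A) (U V : L) : L →ₗ[A] L →ₗ[A] A :=
  G.covBilin (G.covBilin T V) U - G.covBilin T (G.conn U V)

theorem secondCovBilin_flip (T : L →ₗ[A] L →ₗ[A] A) (U V : L) :
    G.secondCovBilin T.flip U V = (G.secondCovBilin T U V).flip := by
  rw [secondCovBilin, covBilin_flip, covBilin_flip, covBilin_flip]
  rfl

theorem ricci_identity_bilin (T : L →ₗ[A] L →ₗ[A] A) (U V Y Z : L) :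
    G.secondCovBilin T U V Y Z - G.secondCovBilin T V U Y Z =
      -T (G.curvature U V Y) Z - T Y (G.curvature U V Z) := by
  have h := lie_lie U V (T Y Z)
  simp only [secondCovBilin, LinearMap.sub_apply, covBilin_apply, curvature_apply, map_sub,
    ← G.torsion_free, AddMonoidHom.sub_apply, lie_sub, sub_lie] at h ⊢
  linear_combination -h

end Forms

section Trace

variable {ι : Type*} [Fintype ι] {e : ι → L}

theorem sum_conn_frame (he : IsParsevalFrame e G.metric) (T : L →ₗ[A] L →ₗ[A] A) (U : L) :
    ∑ i, (T (G.conn U (e i)) (e i) + T (e i) (G.conn U (e i))) = 0 := by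
  have conn_parseval (V : L) :
      ∑ i, (G.metric V (G.conn U (e i)) • e i + G.metric V (e i) • G.conn U (e i)) = 0 := by
    have h := congrArg (G.conn U) (he V)
    simp only [map_sum, leibniz, lie_metric, add_smul, Finset.sum_add_distrib,
      he (G.conn U V)] at h ⊢
    rw [← sub_eq_zero] at h
    rw [← h]
    abel
  have contracted := congrArg (fun φ : ι → A ↦ ∑ j, φ j)
    (funext fun j ↦ congrArg (T (e j)) (conn_parseval (e j)))
  have parseval (V W : L) : ∑ j, G.metric (e j) V * T (e j) W = T V W := by
    simpa only [G.metric_comm V, LinearMap.flip_apply] using he.sum_apply (T.flip W) V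
  simp only [map_sum, map_add, map_smul, smul_eq_mul, map_zero, Finset.sum_const_zero] at contracted
  rw [Finset.sum_comm] at contracted
  simpa only [Finset.sum_add_distrib, parseval] using contracted

/-- The bilinear form `(Y, Z) ↦ ⟨R(Y,V)W, Z⟩`, whose trace is `Ric(V,W)`. -/
def curvatureForm (V W : L) : L →ₗ[A] L →ₗ[A] A := G.metric ∘ₗ (G.curvature.flip V).flip W

theorem curvatureForm_apply (V W Y Z : L) :
    G.curvatureForm V W Y Z = G.metric (G.curvature Y V W) Z := rfl

variable (e)

/-- The Ricci tensor `Ric(V,W) = ∑ i, ⟨R(e i,V)W, e i⟩`, computed in the frame `e`. -/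
def ric : L →ₗ[A] L →ₗ[A] A := ∑ i, (G.curvature (e i)).compr₂ (G.metric.flip (e i))

theorem ric_apply (V W : L) : G.ric e V W = frameTrace e (G.curvatureForm V W) := by
  simp [ric, frameTrace_apply, curvatureForm_apply]

theorem ric_comm [IsAddTorsionFree A] (V W : L) : G.ric e V W = G.ric e W V := by
  simp only [ric_apply, frameTrace_apply, curvatureForm_apply]
  refine Finset.sum_congr rfl fun i _ ↦ ?_
  rw [metric_curvature_pair, metric_curvature_skew, curvature_swap, map_neg, LinearMap.neg_apply,
    neg_neg]

theorem ric_flip [IsAddTorsionFree A] : (G.ric e).flip = G.ric e :=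
  (LinearMap.ext₂ (G.ric_comm e)).symm

/-- The scalar curvature, computed in the frame `e`. -/
def scalar : A := frameTrace e (G.ric e)

variable {e}

theorem ric_eq {κ : Type*} [Fintype κ] {e' : κ → L} (he : IsParsevalFrame e G.metric)
    (he' : IsParsevalFrame e' G.metric) : G.ric e = G.ric e' := by
  ext V W
  rw [ric_apply, ric_apply, he.frameTrace_eq he' G.metric_comm]

theorem scalar_eq {κ : Type*} [Fintype κ] {e' : κ → L} (he : IsParsevalFrame e G.metric)
    (he' : IsParsevalFrame e' G.metric) : G.scalar e = G.scalar e' := by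
  rw [scalar, scalar, G.ric_eq he he', he.frameTrace_eq he' G.metric_comm]

theorem sum_curvature_apply [IsAddTorsionFree A] (he : IsParsevalFrame e G.metric)
    (T : L →ₗ[A] L →ₗ[A] A) :
    ∑ j, ∑ i, T (G.curvature (e j) (e i) (e i)) (e j) = frameContract e (G.ric e) T := by
  have expand (i j : ι) : T (G.curvature (e j) (e i) (e i)) (e j)
      = ∑ k, G.metric (G.curvature (e i) (e k) (e j)) (e i) * T (e k) (e j) := by
    rw [← LinearMap.flip_apply, ← he.sum_apply]
    exact Finset.sum_congr rfl fun k _ ↦ by rw [metric_curvature_pair, LinearMap.flip_apply]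
  rw [← frameContract_flip]
  simp only [expand, frameContract, LinearMap.flip_apply, ric_apply, frameTrace_apply,
    curvatureForm_apply, Finset.sum_mul]
  exact Finset.sum_congr rfl fun j _ ↦ Finset.sum_comm

variable [LieRinehartRing A L]

theorem lie_frameTrace (he : IsParsevalFrame e G.metric) (T : L →ₗ[A] L →ₗ[A] A) (U : L) :
    ⁅U, frameTrace e T⁆ = frameTrace e (G.covBilin T U) := by
  have h := G.sum_conn_frame he T U
  simp only [frameTrace_apply, covBilin_apply, lie_sum, Finset.sum_sub_distrib,
    Finset.sum_add_distrib] at h ⊢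
  linear_combination h

theorem lie_frameTrace_metric (he : IsParsevalFrame e G.metric) (U : L) :
    ⁅U, frameTrace e G.metric⁆ = 0 := by
  simp [G.lie_frameTrace he, covBilin_metric]

variable (e)

/-- The divergence of a one-form; that of `metric X` is the divergence of the field `X`. -/
def divOneForm : (L →ₗ[A] A) →+ A := (frameTrace e).toAddMonoidHom.comp G.covOneForm

theorem divOneForm_apply (α : L →ₗ[A] A) :
    G.divOneForm e α = frameTrace e (G.covOneForm α) := rfl

variable {e} in
theorem divOneForm_eq {κ : Type*} [Fintype κ] {e' : κ → L} (he : IsParsevalFrame e G.metric)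
    (he' : IsParsevalFrame e' G.metric) : G.divOneForm e = G.divOneForm e' := by
  ext α
  rw [divOneForm_apply, divOneForm_apply, he.frameTrace_eq he' G.metric_comm]

/-- The divergence `W ↦ ∑ i, (∇_{e i} T)(e i, W)` of a bilinear form in its first argument. -/
def divBilin : (L →ₗ[A] L →ₗ[A] A) →+ L →ₗ[A] A where
  toFun T := ∑ i, G.covBilin T (e i) (e i)
  map_zero' := by simp
  map_add' T T' := by simp [Finset.sum_add_distrib]

theorem divBilin_apply (T : L →ₗ[A] L →ₗ[A] A) (W : L) :
    G.divBilin e T W = ∑ i, G.covBilin T (e i) (e i) W := by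
  simp [divBilin]

theorem divBilin_const_smul_metric {c : A} (hc : ∀ U : L, ⁅U, c⁆ = 0) :
    G.divBilin e (c • G.metric) = 0 := by
  ext W
  simp [divBilin_apply, G.covBilin_smul_of_lie_eq_zero hc, covBilin_metric]

variable {e}

theorem covBilin_ric (he : IsParsevalFrame e G.metric) (U V W : L) :
    G.covBilin (G.ric e) U V W = ∑ i, G.metric (G.covCurvature U (e i) V W) (e i) := by
  simp only [covBilin_apply, ric_apply, G.lie_frameTrace he]
  simp only [frameTrace_apply, covBilin_apply, curvatureForm_apply, ← Finset.sum_sub_distrib,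
    metric_covCurvature]
  exact Finset.sum_congr rfl fun i _ ↦ by ring

theorem bianchi_contracted [IsAddTorsionFree A] (he : IsParsevalFrame e G.metric) (U : L) :
    ⁅U, G.scalar e⁆ = 2 * G.divBilin e (G.ric e) U := by
  have scalar_eq : ⁅U, G.scalar e⁆
      = ∑ j, ∑ i, G.metric (G.covCurvature U (e i) (e j) (e j)) (e i) := by
    rw [scalar, G.lie_frameTrace he, frameTrace_apply]
    simp only [G.covBilin_ric he]
  have div_eq : G.divBilin e (G.ric e) U
      = ∑ j, ∑ i, G.metric (G.covCurvature (e j) (e i) U (e j)) (e i) := by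
    rw [← ric_flip, divBilin_apply]
    simp only [covBilin_flip, LinearMap.flip_apply, G.covBilin_ric he]
  have bianchi (i j : ι) : G.metric (G.covCurvature U (e i) (e j) (e j)) (e i)
      = G.metric (G.covCurvature (e i) (e j) U (e i)) (e j)
        + G.metric (G.covCurvature (e j) (e i) U (e j)) (e i) := by
    have h := congrArg (fun Y ↦ G.metric Y (e i)) (G.bianchi_second U (e i) (e j) (e j))
    simp only [map_add, LinearMap.add_apply, map_zero, LinearMap.zero_apply] at h
    rw [G.metric_covCurvature_skew (e i), G.covCurvature_swap (e j) U, map_neg,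
      LinearMap.neg_apply] at h
    linear_combination h
  rw [scalar_eq, div_eq, two_mul]
  simp only [bianchi, Finset.sum_add_distrib]
  rw [Finset.sum_comm]

theorem covOneForm_divBilin (he : IsParsevalFrame e G.metric) (T : L →ₗ[A] L →ₗ[A] A) (U W : L) :
    G.covOneForm (G.divBilin e T) U W = ∑ i, G.secondCovBilin T U (e i) (e i) W := by
  let B : L →ₗ[A] L →ₗ[A] A := (G.covBilin T).compr₂ (LinearMap.applyₗ W)
  have lie_div : ⁅U, G.divBilin e T W⁆ = frameTrace e (G.covBilin B U) := by
    rw [← G.lie_frameTrace he, frameTrace_apply, divBilin_apply]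
    rfl
  rw [covOneForm_apply, lie_div, divBilin_apply, frameTrace_apply, ← Finset.sum_sub_distrib]
  refine Finset.sum_congr rfl fun i _ ↦ ?_
  simp only [secondCovBilin, covBilin_apply, LinearMap.sub_apply, B, LinearMap.compr₂_apply,
    LinearMap.applyₗ_apply_apply]
  ring

/-- The two double divergences differ by curvature terms, which the symmetry of the Ricci tensor
cancels. -/
theorem divOneForm_divBilin_flip [IsAddTorsionFree A] (he : IsParsevalFrame e G.metric)
    (T : L →ₗ[A] L →ₗ[A] A) :
    G.divOneForm e (G.divBilin e T.flip) = G.divOneForm e (G.divBilin e T) := by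
  have curvature_terms : ∑ j, ∑ i, (T (G.curvature (e j) (e i) (e i)) (e j)
      + T (e i) (G.curvature (e j) (e i) (e j))) = 0 := by
    have second : ∑ j, ∑ i, T (e i) (G.curvature (e j) (e i) (e j))
        = -frameContract e (G.ric e) T.flip := by
      rw [← G.sum_curvature_apply he, Finset.sum_comm]
      simp only [← Finset.sum_neg_distrib, LinearMap.flip_apply]
      refine Finset.sum_congr rfl fun i _ ↦ Finset.sum_congr rfl fun j _ ↦ ?_
      rw [curvature_swap, map_neg]
    simp only [Finset.sum_add_distrib]
    rw [G.sum_curvature_apply he, second, ← frameContract_flip e _ T.flip, ric_flip,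
      LinearMap.flip_flip, add_neg_cancel]
  have ricci_identity (i j : ι) : G.secondCovBilin T (e j) (e i) (e i) (e j) =
      G.secondCovBilin T (e i) (e j) (e i) (e j) - (T (G.curvature (e j) (e i) (e i)) (e j)
      + T (e i) (G.curvature (e j) (e i) (e j))) := by
    linear_combination G.ricci_identity_bilin T (e j) (e i) (e i) (e j)
  simp only [divOneForm_apply, frameTrace_apply, G.covOneForm_divBilin he, secondCovBilin_flip,
    LinearMap.flip_apply, ricci_identity]
  simp only [Finset.sum_sub_distrib, curvature_terms, sub_zero]
  exact Finset.sum_comm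

/-- Commuting the two derivatives of `X` in `∑ i, ⟨∇²_{e i, V} X, e i⟩` produces the Ricci
tensor. -/
theorem divBilin_flip_covOneForm_metric (he : IsParsevalFrame e G.metric) (X : L) :
    G.divBilin e (G.covOneForm (G.metric X)).flip =
      (G.ric e).flip X + differential (G.divOneForm e (G.metric X)) := by
  ext V
  rw [divBilin_apply, LinearMap.add_apply, LinearMap.flip_apply, differential_apply,
    divOneForm_apply, G.lie_frameTrace he, ric_apply, frameTrace_apply, frameTrace_apply,
    ← Finset.sum_add_distrib]
  refine Finset.sum_congr rfl fun i _ ↦ ?_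
  simp only [covBilin_apply, LinearMap.flip_apply, covOneForm_metric, curvatureForm_apply,
    lie_metric, curvature_apply, ← G.torsion_free, map_sub, AddMonoidHom.sub_apply,
    LinearMap.sub_apply]
  ring

theorem divOneForm_flip_apply (T : L →ₗ[A] L →ₗ[A] A) (X : L) :
    G.divOneForm e (T.flip X) =
      G.divBilin e T X + ∑ i, T (e i) (G.conn (e i) X) := by
  rw [divBilin_apply, ← Finset.sum_add_distrib, divOneForm_apply, frameTrace_apply]
  refine Finset.sum_congr rfl fun i _ ↦ ?_
  simp only [covOneForm_apply, covBilin_apply, LinearMap.flip_apply]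
  ring

end Trace

section Soliton

variable [LieRinehartRing A L] {ι : Type*} [Fintype ι] {e : ι → L} {X : L} {lam : A}

/-- The Lie derivative of the metric, `(Y, Z) ↦ ⟨∇_Y X, Z⟩ + ⟨∇_Z X, Y⟩`. -/
def lieMetric (X : L) : L →ₗ[A] L →ₗ[A] A :=
  G.covOneForm (G.metric X) + (G.covOneForm (G.metric X)).flip

theorem lieMetric_apply (X Y Z : L) :
    G.lieMetric X Y Z = G.metric (G.conn Y X) Z + G.metric (G.conn Z X) Y := by
  simp [lieMetric, covOneForm_metric]

theorem frameTrace_lieMetric (X : L) :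
    frameTrace e (G.lieMetric X) = 2 • G.divOneForm e (G.metric X) := by
  rw [lieMetric, map_add, frameTrace_flip, divOneForm_apply, two_nsmul]

variable (e X lam) in
/-- The Ricci soliton equation `Ric + ½ L_X g = λ g`, doubled, for a function `lam` that is
constant in the sense that all fields annihilate it. -/
structure IsSoliton : Prop where
  lie_const : ∀ U : L, ⁅U, lam⁆ = 0
  eq : 2 • G.ric e + G.lieMetric X = 2 • lam • G.metric

variable {G}

theorem IsSoliton.frameContract_ric_lieMetric (h : G.IsSoliton e X lam)
    (he : IsParsevalFrame e G.metric) :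
    frameContract e (G.ric e) (G.lieMetric X) =
      2 * lam * G.scalar e - 2 * frameContract e (G.ric e) (G.ric e) := by
  have ric_metric : frameContract e (G.ric e) G.metric = G.scalar e := by
    rw [frameContract_comm, he.frameContract_left, scalar]
  have lieMetric_eq : G.lieMetric X = (2 * lam) • G.metric + (-2 : A) • G.ric e := by
    ext U V
    have soliton := LinearMap.congr_fun₂ h.eq U V
    simp only [LinearMap.add_apply, LinearMap.smul_apply, nsmul_eq_mul, Nat.cast_ofNat,
      smul_eq_mul] at soliton ⊢
    linear_combination soliton
  rw [lieMetric_eq, frameContract_add_right, frameContract_smul_right, frameContract_smul_right,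
    ric_metric]
  ring

variable [IsAddTorsionFree A]

theorem IsSoliton.differential_divOneForm_metric (h : G.IsSoliton e X lam)
    (he : IsParsevalFrame e G.metric) :
    differential (G.divOneForm e (G.metric X)) = -differential (L := L) (G.scalar e) := by
  ext V
  have traced := congrArg (fun T ↦ ⁅V, frameTrace e T⁆) h.eq
  simp only [map_add, map_nsmul, map_smul, frameTrace_lieMetric, lie_add, lie_nsmul, smul_eq_mul,
    LieRinehartRing.leibniz_mul_right, h.lie_const, G.lie_frameTrace_metric he, mul_zero, zero_mul,
    add_zero, nsmul_zero, ← nsmul_add] at traced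
  exact eq_neg_of_add_eq_zero_right ((nsmul_eq_zero_iff_right two_ne_zero).mp traced)

theorem IsSoliton.divBilin_covOneForm_metric (h : G.IsSoliton e X lam)
    (he : IsParsevalFrame e G.metric) :
    G.divBilin e (G.covOneForm (G.metric X)) = -(G.ric e).flip X := by
  have two_nsmul_divBilin_ric : 2 • G.divBilin e (G.ric e) = differential (G.scalar e) := by
    ext V
    simp [differential_apply, G.bianchi_contracted he]
  have hdiv := congrArg (G.divBilin e) h.eq
  rw [lieMetric, map_add, map_add, map_nsmul, map_nsmul, two_nsmul_divBilin_ric,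
    G.divBilin_const_smul_metric e h.lie_const, G.divBilin_flip_covOneForm_metric he,
    h.differential_divOneForm_metric he, nsmul_zero] at hdiv
  linear_combination (norm := module) hdiv

theorem IsSoliton.laplacian_scalar_eq_two_nsmul_divOneForm (h : G.IsSoliton e X lam)
    (he : IsParsevalFrame e G.metric) :
    G.divOneForm e (differential (G.scalar e)) = 2 • G.divOneForm e ((G.ric e).flip X) := by
  have hflip := G.divOneForm_divBilin_flip he (G.covOneForm (G.metric X))
  rw [G.divBilin_flip_covOneForm_metric he, h.divBilin_covOneForm_metric he,
    h.differential_divOneForm_metric he, map_add, map_neg, map_neg] at hflip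
  linear_combination -hflip

theorem two_nsmul_sum_ric_conn (he : IsParsevalFrame e G.metric) (X : L) :
    2 • ∑ i, G.ric e (e i) (G.conn (e i) X) = frameContract e (G.ric e) (G.lieMetric X) := by
  have contract_conn : ∑ i, G.ric e (e i) (G.conn (e i) X) =
      frameContract e (G.ric e) (G.covOneForm (G.metric X)) :=
    Finset.sum_congr rfl fun i _ ↦ by
      rw [← he.sum_apply]
      exact Finset.sum_congr rfl fun j _ ↦ by rw [covOneForm_metric, mul_comm]
  rw [lieMetric, frameContract_add_right, ← frameContract_flip e _ (LinearMap.flip _),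
    LinearMap.flip_flip, ric_flip, contract_conn, two_nsmul]

theorem IsSoliton.laplacian_scalar (h : G.IsSoliton e X lam) (he : IsParsevalFrame e G.metric) :
    G.divOneForm e (differential (G.scalar e)) =
      ⁅X, G.scalar e⁆ + 2 * lam * G.scalar e - 2 * frameContract e (G.ric e) (G.ric e) := by
  rw [h.laplacian_scalar_eq_two_nsmul_divOneForm he, divOneForm_flip_apply, nsmul_add,
    two_nsmul_sum_ric_conn he, h.frameContract_ric_lieMetric he, G.bianchi_contracted he, two_nsmul]
  ring

end Soliton

end LeviCivitaStructure

theorem sum_inner_smul_of_orthonormal {W ι : Type*} [NormedAddCommGroup W]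
    [InnerProductSpace ℝ W] [FiniteDimensional ℝ W] [Fintype ι] {v : ι → W}
    (hv : Orthonormal ℝ v) (hcard : Module.finrank ℝ W = Fintype.card ι) (w : W) :
    ∑ i, (inner ℝ w (v i) : ℝ) • v i = w := by
  obtain ⟨b, hb⟩ := Orthonormal.exists_orthonormalBasis_extension_of_card_eq hcard
    (v := v) (s := Set.univ) (hv.comp _ Subtype.val_injective)
  simpa only [hb _ (Set.mem_univ _), real_inner_comm w] using b.sum_repr' w

section OrthonormalFrame

variable {EB : Type*} [NormedAddCommGroup EB] [NormedSpace ℝ EB]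
  {HB : Type*} [TopologicalSpace HB] {IB : ModelWithCorners ℝ EB HB}
  {B : Type*} [TopologicalSpace B] [ChartedSpace HB B] {n : ℕ∞ω}
  {F : Type*} [NormedAddCommGroup F] [NormedSpace ℝ F]
  {V : B → Type*} [TopologicalSpace (TotalSpace F V)] [∀ x, NormedAddCommGroup (V x)]
  [∀ x, InnerProductSpace ℝ (V x)] [FiberBundle F V] [VectorBundle ℝ F V] {s : Set B}

theorem contMDiffAt_of_inner [FiniteDimensional ℝ F] {ι : Type*} [Fintype ι]
    (hcard : Module.finrank ℝ F = Fintype.card ι) {f : ι → Π x, V x} {x : B}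
    (ho : ∀ᶠ y in 𝓝 x, Orthonormal ℝ (f · y)) (hf : ∀ i, CMDiffAt n (T% (f i)) x) {v : Π x, V x}
    (hv : ∀ i, CMDiffAt n (fun y ↦ inner ℝ (v y) (f i y)) x) : CMDiffAt n (T% v) x := by
  have expansion : CMDiffAt n (T% (fun y ↦ ∑ i, (inner ℝ (v y) (f i y) : ℝ) • f i y)) x :=
    .sum_section fun i _ ↦ (hv i).smul_section (hf i)
  refine expansion.congr_of_eventuallyEq (ho.mono fun y hy ↦ congrArg (TotalSpace.mk y) ?_)
  let φ : V y ≃L[ℝ] F :=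
    (trivializationAt F V y).continuousLinearEquivAt ℝ y (mem_baseSet_trivializationAt' y)
  have : FiniteDimensional ℝ (V y) := φ.symm.toLinearEquiv.finiteDimensional
  rw [sum_inner_smul_of_orthonormal hy (φ.toLinearEquiv.finrank_eq.trans hcard)]

variable [IsContMDiffRiemannianBundle IB n F V]

theorem contMDiffOn_inner {v w : Π x, V x} (hv : CMDiff[s] n (T% v)) (hw : CMDiff[s] n (T% w)) :
    CMDiff[s] n (fun x ↦ inner ℝ (v x) (w x)) :=
  ContMDiffOn.inner_bundle (b := id) hv hw

variable {ι : Type*} [LinearOrder ι] [LocallyFiniteOrderBot ι] [WellFoundedLT ι]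
  {f : ι → Π x, V x}

open InnerProductSpace in
theorem contMDiffOn_gramSchmidt (hf : ∀ i, CMDiff[s] n (T% (f i)))
    (hli : ∀ x ∈ s, LinearIndependent ℝ (f · x)) (i : ι) :
    CMDiff[s] n (T% (fun x ↦ gramSchmidt ℝ (f · x) i)) := by
  induction i using WellFoundedLT.induction with
  | _ i ih =>
  simp only [gramSchmidt_def ℝ _ i, Submodule.starProjection_singleton,
    ← real_inner_self_eq_norm_sq]
  refine (hf i).sub_section (.sum_section fun j hj ↦ ?_)
  have hj := ih j (Finset.mem_Iio.1 hj)
  refine .smul_section (.div₀ (contMDiffOn_inner hj (hf i)) (contMDiffOn_inner hj hj) ?_) hj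
  exact fun x hx ↦ inner_self_ne_zero.2 (gramSchmidt_ne_zero j (hli x hx))

open InnerProductSpace in
theorem contMDiffOn_gramSchmidtNormed (hf : ∀ i, CMDiff[s] n (T% (f i)))
    (hli : ∀ x ∈ s, LinearIndependent ℝ (f · x)) (i : ι) :
    CMDiff[s] n (T% (fun x ↦ gramSchmidtNormed ℝ (f · x) i)) := by
  have hi := contMDiffOn_gramSchmidt hf hli i
  have hne {x} (hx : x ∈ s) : gramSchmidt ℝ (f · x) i ≠ 0 := gramSchmidt_ne_zero i (hli x hx)
  refine ContMDiffOn.smul_section (.inv₀ ?_ fun x hx ↦ norm_ne_zero_iff.2 (hne hx)) hi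
  simp only [norm_eq_sqrt_real_inner]
  exact fun x hx ↦ ContMDiffAt.comp_contMDiffWithinAt (g := Real.sqrt) x
    (Real.contDiffAt_sqrt (inner_self_ne_zero.2 (hne hx))).contMDiffAt
    (contMDiffOn_inner hi hi x hx)

theorem exists_contMDiffOn_orthonormal [FiniteDimensional ℝ F] [ContMDiffVectorBundle n F V IB]
    (x₀ : B) : ∃ u ∈ 𝓝 x₀, ∃ e : Fin (Module.finrank ℝ F) → Π x, V x,
      (∀ i, CMDiff[u] n (T% (e i))) ∧ ∀ x ∈ u, Orthonormal ℝ (e · x) := by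
  set t := trivializationAt F V x₀
  have ht := t.isLocalFrameOn_localFrame_baseSet IB n (Module.finBasis ℝ F)
  exact ⟨t.baseSet, t.open_baseSet.mem_nhds (mem_baseSet_trivializationAt' x₀), _,
    contMDiffOn_gramSchmidtNormed ht.contMDiffOn fun x hx ↦ ht.linearIndependent hx,
    fun x hx ↦ InnerProductSpace.gramSchmidtNormed_orthonormal (ht.linearIndependent hx)⟩

end OrthonormalFrame

section VectorField

variable {E : Type*} [NormedAddCommGroup E] [NormedSpace ℝ E] {H : Type*} [TopologicalSpace H]
  {I : ModelWithCorners ℝ E H} {M : Type*} [TopologicalSpace M] [ChartedSpace H M] {x : M}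

theorem mvfderiv_congr {F : Type*} [NormedAddCommGroup F] [NormedSpace ℝ F] {f g : M → F}
    (h : f =ᶠ[𝓝 x] g) : mvfderiv I f x = mvfderiv I g x := by
  rw [mvfderiv, mvfderiv, h.mfderiv_eq, h.eq_of_nhds]

theorem contMDiffAt_mvfderiv [IsManifold I 1 M] {F : Type*} [NormedAddCommGroup F]
    [NormedSpace ℝ F] {m n : ℕ∞ω} {f : M → F} {V : Π x : M, TangentSpace I x}
    (hf : CMDiffAt n f x) (hV : CMDiffAt m (T% V) x) (hmn : m + 1 ≤ n) :
    CMDiffAt m (fun y ↦ mvfderiv I f y (V y)) x :=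
  (contMDiff_snd_tangentBundle_modelSpace F 𝓘(ℝ, F)).contMDiffAt.comp x <|
    ContMDiffAt.clm_apply_of_inCoordinates (hf.mfderiv_const hmn) hV
      (hf.of_le (le_self_add.trans hmn))

variable [CompleteSpace E] [IsManifold I 3 M] {f : M → ℝ} {U V W : Π x : M, TangentSpace I x}

theorem mlieBracket_mlieBracket_smul (hf : CMDiffAt 2 f x) (hV : CMDiffAt 2 (T% V) x)
    (hW : CMDiffAt 2 (T% W) x) :
    mlieBracket I U (mlieBracket I V (f • W)) x
      = mvfderiv I (fun y ↦ mvfderiv I f y (V y)) x (U x) • W x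
        + mvfderiv I f x (V x) • mlieBracket I U W x
        + (mvfderiv I f x (U x) • mlieBracket I V W x
          + f x • mlieBracket I U (mlieBracket I V W) x) := by
  have : IsManifold I ((2 : ℕ∞) + 1) M := ‹IsManifold I 3 M›
  have : IsManifold I (minSmoothness ℝ 2) M := by simpa using .of_le (n := 3) (by norm_num)
  have : IsManifold I (1 + 1) M := .of_le (n := 3) (by norm_num)
  have hVf : MDiffAt (fun y ↦ mvfderiv I f y (V y)) x :=
    (contMDiffAt_mvfderiv hf (hV.of_le one_le_two) (by norm_num)).mdifferentiableAt one_ne_zero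
  have hVW : MDiffAt (T% (mlieBracket I V W)) x :=
    (hV.mlieBracket_vectorField (m := 1) (n := 2) hW
      (by norm_num)).mdifferentiableAt one_ne_zero
  have hf1 := hf.mdifferentiableAt two_ne_zero
  have hW1 := hW.mdifferentiableAt two_ne_zero
  have product_rule : mlieBracket I V (f • W) =ᶠ[𝓝 x]
      (fun y ↦ mvfderiv I f y (V y)) • W + f • mlieBracket I V W := by
    filter_upwards [(contMDiffAt_iff_contMDiffAt_nhds (by simp)).1 hf,
      (contMDiffAt_iff_contMDiffAt_nhds (by simp)).1 (hW.of_le one_le_two)] with y hfy hWy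
    exact mlieBracket_smul_right (hfy.mdifferentiableAt two_ne_zero)
      (hWy.mdifferentiableAt one_ne_zero)
  rw [Filter.EventuallyEq.rfl.mlieBracket_vectorField_eq product_rule,
    mlieBracket_add_right (hVf.smul_section hW1) (hf1.smul_section hVW),
    mlieBracket_smul_right hVf hW1, mlieBracket_smul_right hf1 hVW]

theorem mvfderiv_mlieBracket (hf : CMDiffAt 2 f x) (hU : CMDiffAt 2 (T% U) x)
    (hV : CMDiffAt 2 (T% V) x) :
    mvfderiv I f x (mlieBracket I U V x)
      = mvfderiv I (fun y ↦ mvfderiv I f y (V y)) x (U x)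
        - mvfderiv I (fun y ↦ mvfderiv I f y (U y)) x (V x) := by
  rcases subsingleton_or_nontrivial (TangentSpace I x) with h | h
  · simp [Subsingleton.elim _ (0 : TangentSpace I x)]
  -- Compare the coefficients of a nowhere vanishing `W` in the Jacobi identity for `U, V, f • W`.
  obtain ⟨w, hw⟩ := exists_ne (0 : TangentSpace I x)
  set W := extend E w
  have hW : CMDiffAt 2 (T% W) x := contMDiffAt_extend I E w
  have jacobi {W : Π x : M, TangentSpace I x} (hW : CMDiffAt 2 (T% W) x) :
      mlieBracket I U (mlieBracket I V W) x
        = mlieBracket I (mlieBracket I U V) W x + mlieBracket I V (mlieBracket I U W) x := by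
    have : IsManifold I (minSmoothness ℝ 3) M := by simpa
    exact leibniz_identity_mlieBracket_apply (by simpa) (by simpa) (by simpa)
  have h := jacobi (hf.smul_section hW)
  rw [mlieBracket_mlieBracket_smul hf hV hW, mlieBracket_mlieBracket_smul hf hU hW,
    mlieBracket_smul_right (hf.mdifferentiableAt two_ne_zero) (hW.mdifferentiableAt two_ne_zero),
    jacobi hW] at h
  have hWx : W x ≠ 0 := by simpa only [W, extend_apply_self] using hw
  refine (smul_left_injective ℝ hWx (sub_eq_zero.1 ?_)).symm
  rw [← sub_eq_zero.2 h]
  module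

end VectorField

noncomputable section LocalFields

variable {E : Type*} [NormedAddCommGroup E] [NormedSpace ℝ E] {H : Type*} [TopologicalSpace H]
  {I : ModelWithCorners ℝ E H} {M : Type*} [TopologicalSpace M] [ChartedSpace H M]
  {s : Set M} {x : M}

variable (I) in
/-- The algebra of functions on `M` that are smooth at every point of `s`. -/
def smoothOn (s : Set M) : Subalgebra ℝ (M → ℝ) where
  carrier := {f | ∀ x ∈ s, CMDiffAt ∞ f x}
  mul_mem' hf hg x hx := (hf x hx).mul (hg x hx)
  add_mem' hf hg x hx := (hf x hx).add (hg x hx)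
  algebraMap_mem' _ _ _ := contMDiffAt_const

instance : CommRing (smoothOn I s) := (smoothOn I s).toCommRing

instance : Algebra ℝ (smoothOn I s) := (smoothOn I s).algebra

instance : IsAddTorsionFree (smoothOn I s) :=
  Function.Injective.isAddTorsionFree (smoothOn I s).val.toAddMonoidHom Subtype.val_injective

theorem smoothOn.sum_apply {ι : Type*} (t : Finset ι) (f : ι → smoothOn I s) (x : M) :
    (∑ i ∈ t, f i).1 x = ∑ i ∈ t, (f i).1 x := by
  rw [AddSubmonoidClass.coe_finsetSum, Finset.sum_apply]

theorem smoothOn.mdifferentiableAt (f : smoothOn I s) (hx : x ∈ s) : MDiffAt f.1 x :=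
  (f.2 x hx).mdifferentiableAt (by simp)

variable [IsManifold I ∞ M]

theorem contMDiffAt_mlieBracket [CompleteSpace E] {U V : Π x : M, TangentSpace I x}
    (hU : CMDiffAt ∞ (T% U) x) (hV : CMDiffAt ∞ (T% V) x) :
    CMDiffAt ∞ (T% (mlieBracket I U V)) x := by
  have : IsManifold I (minSmoothness ℝ 2) M := by simpa using .of_le (n := ∞) (by norm_cast)
  have : IsManifold I (((⊤ : ℕ∞) : ℕ∞ω) + 1) M := by simpa
  exact hU.mlieBracket_vectorField (m := ⊤) (n := ⊤) hV (by simp)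

variable (I) in
/-- The module of vector fields that are smooth at every point of `s`. They are required to vanish
outside `s`, so that two of them are equal as soon as they agree on `s`. -/
def fieldsOn (s : Set M) : Submodule (smoothOn I s) (Π x : M, TangentSpace I x) where
  carrier := {V | (∀ x ∈ s, CMDiffAt ∞ (T% V) x) ∧ ∀ x ∉ s, V x = 0}
  add_mem' hU hV := ⟨fun x hx ↦ (hU.1 x hx).add_section (hV.1 x hx),
    fun x hx ↦ by simp [hU.2 x hx, hV.2 x hx]⟩
  zero_mem' := ⟨fun x _ ↦ (contMDiff_zeroSection ℝ (TangentSpace I (M := M))).contMDiffAt,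
    fun _ _ ↦ rfl⟩
  smul_mem' f V hV := ⟨fun x hx ↦ (f.2 x hx).smul_section (hV.1 x hx),
    fun x hx ↦ (congrArg (f.1 x • ·) (hV.2 x hx)).trans (smul_zero _)⟩

instance : AddCommGroup (fieldsOn I s) := (fieldsOn I s).addCommGroup

instance : Module (smoothOn I s) (fieldsOn I s) := (fieldsOn I s).module

-- Shortcut: without it instance search tries to scale fields by the ambient `M → ℝ` and is slow.
instance : SMul (smoothOn I s) (fieldsOn I s) := Module.toDistribMulAction.toSMul

theorem fieldsOn.sum_apply {ι : Type*} (t : Finset ι) (V : ι → fieldsOn I s) (x : M) :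
    (∑ i ∈ t, V i).1 x = ∑ i ∈ t, (V i).1 x := by
  rw [AddSubmonoidClass.coe_finsetSum, Finset.sum_apply]

theorem fieldsOn.mdifferentiableAt (V : fieldsOn I s) (hx : x ∈ s) : MDiffAt (T% V.1) x :=
  (V.2.1 x hx).mdifferentiableAt (by simp)

theorem fieldsOn.ext {U V : fieldsOn I s} (h : ∀ x ∈ s, U.1 x = V.1 x) : U = V := by
  ext x
  by_cases hx : x ∈ s
  · exact h x hx
  · rw [U.2.2 x hx, V.2.2 x hx]

open scoped Classical in
/-- The restriction to the open set `s` of a vector field that is smooth at the points of `s`. -/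
def toFieldsOn (hs : IsOpen s) (V : Π x : M, TangentSpace I x)
    (hV : ∀ x ∈ s, CMDiffAt ∞ (T% V) x) : fieldsOn I s :=
  ⟨s.piecewise V 0, fun x hx ↦ (hV x hx).congr_of_eventuallyEq <| by
    filter_upwards [hs.mem_nhds hx] with y hy
    rw [Set.piecewise_eq_of_mem _ _ _ hy], fun x hx ↦ Set.piecewise_eq_of_notMem _ _ _ hx⟩

theorem toFieldsOn_apply (hs : IsOpen s) {V : Π x : M, TangentSpace I x}
    (hV : ∀ x ∈ s, CMDiffAt ∞ (T% V) x) (hx : x ∈ s) : (toFieldsOn hs V hV).1 x = V x := by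
  classical exact Set.piecewise_eq_of_mem _ _ _ hx

theorem toFieldsOn_eventuallyEq (hs : IsOpen s) {V : Π x : M, TangentSpace I x}
    (hV : ∀ x ∈ s, CMDiffAt ∞ (T% V) x) (hx : x ∈ s) : (toFieldsOn hs V hV).1 =ᶠ[𝓝 x] V :=
  Filter.eventually_of_mem (hs.mem_nhds hx) fun _ ↦ toFieldsOn_apply hs hV

variable [CompleteSpace E]

instance : LieRing (fieldsOn I s) where
  bracket U V := ⟨mlieBracket I U.1 V.1,
    fun x hx ↦ contMDiffAt_mlieBracket (U.2.1 x hx) (V.2.1 x hx), fun x hx ↦ by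
      rw [← mlieBracketWithin_univ, mlieBracketWithin_eq_zero_of_eq_zero (U.2.2 x hx) (V.2.2 x hx)]⟩
  add_lie U V W := fieldsOn.ext fun x hx ↦
    mlieBracket_add_left (fieldsOn.mdifferentiableAt U hx) (fieldsOn.mdifferentiableAt V hx)
  lie_add U V W := fieldsOn.ext fun x hx ↦
    mlieBracket_add_right (fieldsOn.mdifferentiableAt V hx) (fieldsOn.mdifferentiableAt W hx)
  lie_self U := fieldsOn.ext fun x _ ↦ congrFun mlieBracket_self x
  leibniz_lie U V W := fieldsOn.ext fun x hx ↦ by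
    have : IsManifold I (minSmoothness ℝ 3) M := by simpa using .of_le (n := ∞) (by norm_cast)
    have smooth (Y : fieldsOn I s) : CMDiffAt (minSmoothness ℝ 2) (T% Y.1) x :=
      (Y.2.1 x hx).of_le (by rw [minSmoothness_of_isRCLikeNormedField]; norm_cast)
    exact leibniz_identity_mlieBracket_apply (smooth U) (smooth V) (smooth W)

instance : LieRingModule (fieldsOn I s) (smoothOn I s) where
  bracket V f := ⟨fun x ↦ mvfderiv I f.1 x (V.1 x), fun x hx ↦
    contMDiffAt_mvfderiv (f.2 x hx) (V.2.1 x hx) le_rfl⟩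
  add_lie U V f := Subtype.ext <| funext fun x ↦ map_add (mvfderiv I f.1 x) _ _
  lie_add V f g := Subtype.ext <| funext fun x ↦ by
    by_cases hx : x ∈ s
    · exact congrArg (· (V.1 x)) (mvfderiv_add (smoothOn.mdifferentiableAt f hx)
        (smoothOn.mdifferentiableAt g hx))
    · simp [V.2.2 x hx]
  leibniz_lie U V f := Subtype.ext <| funext fun x ↦ by
    by_cases hx : x ∈ s
    · have : IsManifold I 3 M := .of_le (n := ∞) (by norm_cast)
      have smooth (Y : fieldsOn I s) : CMDiffAt 2 (T% Y.1) x := (Y.2.1 x hx).of_le (by norm_cast)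
      exact eq_add_of_sub_eq
        (mvfderiv_mlieBracket ((f.2 x hx).of_le (by norm_cast)) (smooth U) (smooth V)).symm
    · have hUV : (⁅U, V⁆ : fieldsOn I s).1 x = 0 := ⁅U, V⁆.2.2 x hx
      simp [U.2.2 x hx, V.2.2 x hx, hUV]

theorem fieldsOn.lie_smoothOn_apply (V : fieldsOn I s) (f : smoothOn I s) (x : M) :
    ⁅V, f⁆.1 x = mvfderiv I f.1 x (V.1 x) := rfl

instance : LieRinehartRing (smoothOn I s) (fieldsOn I s) where
  lie_smul_eq_mul' f g V := Subtype.ext <| funext fun x ↦ map_smul (mvfderiv I g.1 x) _ _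
  leibniz_mul_right' V f g := Subtype.ext <| funext fun x ↦ by
    by_cases hx : x ∈ s
    · refine (congrArg (· (V.1 x)) (mvfderiv_mul
        (smoothOn.mdifferentiableAt f hx) (smoothOn.mdifferentiableAt g hx))).trans ?_
      exact congrArg (f.1 x * mvfderiv I g.1 x (V.1 x) + ·) (mul_comm _ _)
    · change mvfderiv I (f * g).1 x (V.1 x)
        = f.1 x * mvfderiv I g.1 x (V.1 x) + mvfderiv I f.1 x (V.1 x) * g.1 x
      simp [V.2.2 x hx]
  leibniz_smul_right' U V f := fieldsOn.ext fun x hx ↦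
    (mlieBracket_smul_right (smoothOn.mdifferentiableAt f hx)
      (fieldsOn.mdifferentiableAt V hx)).trans (add_comm _ _)

end LocalFields

noncomputable section LeviCivita

variable {E : Type*} [NormedAddCommGroup E] [NormedSpace ℝ E]
  {H : Type*} [TopologicalSpace H] {I : ModelWithCorners ℝ E H}
  {M : Type*} [TopologicalSpace M] [ChartedSpace H M] [IsManifold I ∞ M]
  [RiemannianBundle (fun x : M ↦ TangentSpace I x)]
  [IsContMDiffRiemannianBundle I ∞ E (fun x : M ↦ TangentSpace I x)]
  {s : Set M} {x : M} {U U' V V' W W' : Π x : M, TangentSpace I x}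

theorem contMDiffAt_inner (hU : CMDiffAt ∞ (T% U) x) (hV : CMDiffAt ∞ (T% V) x) :
    CMDiffAt ∞ (fun y ↦ inner ℝ (U y) (V y)) x :=
  ContMDiffAt.inner_bundle (F := E) (E := fun x : M ↦ TangentSpace I x) (b := id) hU hV

variable [FiniteDimensional ℝ E]

theorem leviCivita_congr (h : V =ᶠ[𝓝 x] V') : leviCivita I M V x = leviCivita I M V' x := by
  have hT : (T% V) =ᶠ[𝓝 x] T% V' := h.mono fun y hy ↦ congrArg (TotalSpace.mk y) hy
  by_cases hV : MDiffAt (T% V) x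
  · exact isCovariantDerivativeOn_leviCivitaFun.congr_of_eventuallyEq hV
      (hV.congr_of_eventuallyEq hT.symm) Filter.univ_mem h
  · have hV' := hT.mdifferentiableAt_iff.not.1 hV
    change leviCivitaFun V x = leviCivitaFun V' x
    rw [leviCivitaFun, leviCivitaFun, dif_neg hV, dif_neg hV']

theorem curvature_congr (hU : U =ᶠ[𝓝 x] U') (hV : V =ᶠ[𝓝 x] V') (hW : W =ᶠ[𝓝 x] W') :
    curvature U V W x = curvature U' V' W' x := by
  have leviCivita_comp {V V' : Π x : M, TangentSpace I x} (hV : V =ᶠ[𝓝 x] V') :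
      (fun y ↦ leviCivita I M W y (V y)) =ᶠ[𝓝 x] fun y ↦ leviCivita I M W' y (V' y) := by
    filter_upwards [hV, hW.eventuallyEq_nhds] with y hVy hWy
    rw [leviCivita_congr hWy, hVy]
  rw [curvature, curvature, leviCivita_congr (leviCivita_comp hV),
    leviCivita_congr (leviCivita_comp hU), leviCivita_congr hW,
    hU.mlieBracket_vectorField_eq hV, hU.eq_of_nhds, hV.eq_of_nhds]

theorem leviCivita_sub_leviCivita (hU : MDiffAt (T% U) x) (hV : MDiffAt (T% V) x) :
    leviCivita I M V x (U x) - leviCivita I M U x (V x) = mlieBracket I U V x :=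
  (CovariantDerivative.torsion_eq_zero_iff _).1 leviCivita_torsion hU hV

theorem contMDiffAt_koszul (hU : CMDiffAt ∞ (T% U) x) (hV : CMDiffAt ∞ (T% V) x)
    (hW : CMDiffAt ∞ (T% W) x) : CMDiffAt ∞ (koszul U V W) x := by
  have lie_inner {U V W : Π x : M, TangentSpace I x} (hU : CMDiffAt ∞ (T% U) x)
      (hV : CMDiffAt ∞ (T% V) x) (hW : CMDiffAt ∞ (T% W) x) :
      CMDiffAt ∞ (fun y ↦ mvfderiv I (fun z ↦ inner ℝ (V z) (W z)) y (U y)) x :=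
    contMDiffAt_mvfderiv (contMDiffAt_inner hV hW) hU le_rfl
  exact (((((lie_inner hV hU hW).add (lie_inner hU hW hV)).sub (lie_inner hW hV hU)).add
    (contMDiffAt_inner (contMDiffAt_mlieBracket hV hU) hW)).sub
    (contMDiffAt_inner (contMDiffAt_mlieBracket hU hW) hV)).add
    (contMDiffAt_inner (contMDiffAt_mlieBracket hW hV) hU)

theorem contMDiffAt_leviCivita (hU : CMDiffAt ∞ (T% U) x) (hV : CMDiffAt ∞ (T% V) x) :
    CMDiffAt ∞ (T% (fun y ↦ leviCivita I M V y (U y))) x := by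
  obtain ⟨u, hu, e, he, ho⟩ := exists_contMDiffOn_orthonormal (IB := I) (n := ∞) (F := E)
    (V := fun x : M ↦ TangentSpace I x) x
  have hex (i) : CMDiffAt ∞ (T% (e i)) x := (he i).contMDiffAt hu
  refine contMDiffAt_of_inner (V := fun x : M ↦ TangentSpace I x) (Fintype.card_fin _).symm
    (Filter.eventually_of_mem hu ho) hex fun i ↦ ?_
  have mdifferentiableAt_nhds {Y : Π x : M, TangentSpace I x} (hY : CMDiffAt ∞ (T% Y) x) :
      ∀ᶠ y in 𝓝 x, MDiffAt (T% Y) y := by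
    filter_upwards [(contMDiffAt_iff_contMDiffAt_nhds (by simp)).1
      (hY.of_le (by norm_cast : (1 : ℕ∞ω) ≤ ∞))] with y hy
    exact hy.mdifferentiableAt one_ne_zero
  refine ((contMDiffAt_const (c := (1 / 2 : ℝ))).mul
    (contMDiffAt_koszul hV hU (hex i))).congr_of_eventuallyEq ?_
  filter_upwards [mdifferentiableAt_nhds hU, mdifferentiableAt_nhds hV,
    mdifferentiableAt_nhds (hex i)] with y hUy hVy hey
  change inner ℝ (leviCivitaFun V y (U y)) (e i y) = 1 / 2 * koszul V U (e i) y
  rw [← two_mul_inner_leviCivitaFun hVy hUy hey]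
  ring

variable (I s) in
/-- The Levi-Civita connection and the metric on the vector fields that are smooth on `s`. -/
def leviCivitaOn : LeviCivitaStructure (smoothOn I s) (fieldsOn I s) where
  metric := LinearMap.mk₂ (smoothOn I s)
    (fun U V ↦ ⟨fun y ↦ inner ℝ (U.1 y) (V.1 y), fun y hy ↦
      contMDiffAt_inner (U.2.1 y hy) (V.2.1 y hy)⟩)
    (fun U U' V ↦ by ext y; exact inner_add_left (U.1 y) (U'.1 y) (V.1 y))
    (fun f U V ↦ by ext y; exact real_inner_smul_left (U.1 y) (V.1 y) (f.1 y))
    (fun U V V' ↦ by ext y; exact inner_add_right (U.1 y) (V.1 y) (V'.1 y))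
    (fun f U V ↦ by ext y; exact real_inner_smul_right (U.1 y) (V.1 y) (f.1 y))
  conn :=
    { toFun := fun U ↦ AddMonoidHom.mk' (fun V ↦ ⟨fun y ↦ leviCivita I M V.1 y (U.1 y),
        fun y hy ↦ contMDiffAt_leviCivita (U.2.1 y hy) (V.2.1 y hy),
        fun y hy ↦ (congrArg _ (U.2.2 y hy)).trans (map_zero _)⟩)
        fun V W ↦ fieldsOn.ext fun y hy ↦ congrArg (· (U.1 y)) <|
          isCovariantDerivativeOn_leviCivitaFun.add (fieldsOn.mdifferentiableAt V hy)
            (fieldsOn.mdifferentiableAt W hy)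
      map_add' := fun U V ↦ by ext W y; exact map_add (leviCivita I M W.1 y) (U.1 y) (V.1 y)
      map_smul' := fun f U ↦ by ext W y; exact map_smul (leviCivita I M W.1 y) (f.1 y) (U.1 y) }
  metric_comm U V := by ext y; exact real_inner_comm _ _
  leibniz U V f := fieldsOn.ext fun y hy ↦ congrArg (· (U.1 y)) <|
    isCovariantDerivativeOn_leviCivitaFun.leibniz (fieldsOn.mdifferentiableAt V hy)
      (smoothOn.mdifferentiableAt f hy)
  torsion_free U V := fieldsOn.ext fun y hy ↦
    leviCivita_sub_leviCivita (fieldsOn.mdifferentiableAt U hy) (fieldsOn.mdifferentiableAt V hy)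
  lie_metric U V W := by
    ext y
    by_cases hy : y ∈ s
    · exact leviCivita_metric (fieldsOn.mdifferentiableAt U hy) (fieldsOn.mdifferentiableAt V hy)
        (fieldsOn.mdifferentiableAt W hy)
    · change mvfderiv I (fun y ↦ inner ℝ (V.1 y) (W.1 y)) y (U.1 y)
        = inner ℝ (leviCivita I M V.1 y (U.1 y)) (W.1 y)
          + inner ℝ (V.1 y) (leviCivita I M W.1 y (U.1 y))
      simp [U.2.2 y hy]

end LeviCivita

noncomputable section Geometry

variable {E : Type*} [NormedAddCommGroup E] [NormedSpace ℝ E] [FiniteDimensional ℝ E]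
  {H : Type*} [TopologicalSpace H] {I : ModelWithCorners ℝ E H}
  {M : Type*} [TopologicalSpace M] [ChartedSpace H M]
  [RiemannianBundle (fun x : M ↦ TangentSpace I x)]

theorem inner_gradient (f : M → ℝ) (x : M) (v : TangentSpace I x) :
    inner ℝ (gradient I f x) v = mvfderiv I f x v := by
  conv_rhs => rw [← (onb I x).sum_repr' v]
  simp [gradient, sum_inner, inner_smul_left, mul_comm]


theorem normSq_sub_trace {x : M} (B : TangentSpace I x → TangentSpace I x → ℝ) {m : ℕ}
    (hm : Module.finrank ℝ E = m) :
    (∑ i, B (onb I x i) (onb I x i)) ^ 2 / m + normSq (fun u v : TangentSpace I x ↦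
      B u v - (∑ i, B (onb I x i) (onb I x i)) / m * inner ℝ u v) = normSq B := by
  set S := ∑ i, B (onb I x i) (onb I x i) with hS
  have expand (i j) : (B (onb I x i) (onb I x j) - S / m * inner ℝ (onb I x i) (onb I x j)) ^ 2
      = B (onb I x i) (onb I x j) ^ 2
        + if i = j then (S / m) ^ 2 - 2 * (S / m) * B (onb I x i) (onb I x j) else 0 := by
    rw [orthonormal_iff_ite.1 (onb I x).orthonormal]
    split_ifs <;> ring
  have hcard : Module.finrank ℝ (TangentSpace I x) = m := hm
  simp only [normSq, expand, Finset.sum_add_distrib, Finset.sum_ite_eq, Finset.mem_univ, if_true,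
    Finset.sum_sub_distrib, ← Finset.mul_sum, ← hS, Finset.sum_const, Finset.card_univ,
    Fintype.card_fin, hcard, nsmul_eq_mul]
  rcases eq_or_ne (m : ℝ) 0 with h0 | h0
  · simp [h0]
  · field_simp
    ring

variable [IsManifold I ∞ M] {s u : Set M} {x : M} {e : Fin (Module.finrank ℝ E) → fieldsOn I s}

/-- Vector fields on `s`, as many as the dimension, that are orthonormal at every point of `s`. -/
def IsOrthonormalFrame (e : Fin (Module.finrank ℝ E) → fieldsOn I s) : Prop :=
  ∀ x ∈ s, Orthonormal ℝ fun i ↦ (e i).1 x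

variable [IsContMDiffRiemannianBundle I ∞ E (fun x : M ↦ TangentSpace I x)]

theorem exists_isOrthonormalFrame (hu : u ∈ 𝓝 x) : ∃ s ⊆ u, IsOpen s ∧ x ∈ s ∧
    ∃ e : Fin (Module.finrank ℝ E) → fieldsOn I s, IsOrthonormalFrame e := by
  obtain ⟨v, hv, f, hf, ho⟩ := exists_contMDiffOn_orthonormal (IB := I) (n := ∞) (F := E)
    (V := fun x : M ↦ TangentSpace I x) x
  have hs : IsOpen (interior (u ∩ v)) := isOpen_interior
  have hsv : interior (u ∩ v) ⊆ v := interior_subset.trans Set.inter_subset_right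
  refine ⟨_, interior_subset.trans Set.inter_subset_left, hs,
    mem_interior_iff_mem_nhds.2 (Filter.inter_mem hu hv), fun i ↦ toFieldsOn hs (f i) fun y hy ↦
      (hf i).contMDiffAt (Filter.mem_of_superset (hs.mem_nhds hy) hsv), fun y hy ↦ ?_⟩
  simpa only [toFieldsOn_apply hs _ hy] using ho y (hsv hy)

theorem IsOrthonormalFrame.isParsevalFrame (he : IsOrthonormalFrame e) :
    IsParsevalFrame e (leviCivitaOn I s).metric := fun V ↦ fieldsOn.ext fun y hy ↦ by
  rw [fieldsOn.sum_apply]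
  exact sum_inner_smul_of_orthonormal (he y hy) (Fintype.card_fin _).symm (V.1 y)

theorem IsOrthonormalFrame.exists_isParsevalFrame_eq_onb (he : IsOrthonormalFrame e)
    (hx : x ∈ s) : ∃ e' : Fin (Module.finrank ℝ (TangentSpace I x)) → fieldsOn I s,
      IsParsevalFrame e' (leviCivitaOn I s).metric ∧ ∀ i, (e' i).1 x = onb I x i := by
  let c i j : smoothOn I s := algebraMap ℝ _ (inner ℝ (onb I x i) ((e j).1 x))
  refine ⟨fun i ↦ ∑ j, c i j • e j, he.isParsevalFrame.rotate fun j k ↦ ?_, fun i ↦ ?_⟩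
  · have h := (onb I x).sum_inner_mul_inner ((e j).1 x) ((e k).1 x)
    rw [orthonormal_iff_ite.1 (he x hx) j k] at h
    simp only [real_inner_comm (onb I x _) ((e j).1 x)] at h
    simp only [c, ← map_mul, ← map_sum, h]
    split_ifs <;> simp
  · rw [fieldsOn.sum_apply]
    exact sum_inner_smul_of_orthonormal (he x hx) (Fintype.card_fin _).symm (onb I x i)

section Parseval

variable {ι : Type*} [Fintype ι] {e : ι → fieldsOn I s}

theorem IsParsevalFrame.map_apply_congr (he : IsParsevalFrame e (leviCivitaOn I s).metric)
    (φ : fieldsOn I s →ₗ[smoothOn I s] fieldsOn I s) {U V : fieldsOn I s} (h : U.1 x = V.1 x) :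
    (φ U).1 x = (φ V).1 x := by
  have expansion (U : fieldsOn I s) :
      (φ U).1 x = ∑ i, (inner ℝ (U.1 x) ((e i).1 x) : ℝ) • (φ (e i)).1 x := by
    conv_lhs => rw [← he U]
    rw [map_sum, fieldsOn.sum_apply]
    exact Finset.sum_congr rfl fun i _ ↦ congrArg (·.1 x) (map_smul φ _ (e i))
  rw [expansion U, expansion V, h]

theorem IsParsevalFrame.curvature_apply_congr
    (he : IsParsevalFrame e (leviCivitaOn I s).metric) {U U' V V' W W' : fieldsOn I s}
    (hU : U.1 x = U'.1 x) (hV : V.1 x = V'.1 x) (hW : W.1 x = W'.1 x) :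
    curvature U.1 V.1 W.1 x = curvature U'.1 V'.1 W'.1 x := by
  let R := (leviCivitaOn I s).curvature
  have swap (U V : fieldsOn I s) : (R U V W').1 x = -(R V U W').1 x :=
    congrArg (·.1 x) ((leviCivitaOn I s).curvature_swap U V W')
  calc (R U V W).1 x = (R U V W').1 x := he.map_apply_congr (R U V) hW
    _ = (R U V' W').1 x := he.map_apply_congr ((R U).flip W') hV
    _ = -(R V' U W').1 x := swap U V'
    _ = -(R V' U' W').1 x := congrArg _ (he.map_apply_congr ((R V').flip W') hU)
    _ = (R U' V' W').1 x := (swap U' V').symm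

end Parseval

theorem riemannTensor_apply (hs : IsOpen s) (hx : x ∈ s) (U V W : fieldsOn I s) :
    riemannTensor x (U.1 x) (V.1 x) (W.1 x) = ((leviCivitaOn I s).curvature U V W).1 x := by
  choose u hu smooth_extend using fun Y : fieldsOn I s ↦
    exists_contMDiffOn_extend I E (k := ∞) (Y.1 x)
  obtain ⟨t, htu, ht, hxt, f, hf⟩ := exists_isOrthonormalFrame (I := I) <|
    Filter.inter_mem (hs.mem_nhds hx) (Filter.inter_mem (hu U) (Filter.inter_mem (hu V) (hu W)))
  let res (Y : fieldsOn I s) : fieldsOn I t := toFieldsOn ht Y.1 fun y hy ↦ Y.2.1 y (htu hy).1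
  let ext (Y : fieldsOn I s) (hY : t ⊆ u Y) : fieldsOn I t :=
    toFieldsOn ht (extend E (Y.1 x)) fun y hy ↦
      (smooth_extend Y).contMDiffAt (Filter.mem_of_superset (ht.mem_nhds hy) hY)
  have res_eq (Y) : (res Y).1 =ᶠ[𝓝 x] Y.1 := toFieldsOn_eventuallyEq ht _ hxt
  have ext_eq (Y) (hY : t ⊆ u Y) :
      (ext Y hY).1 =ᶠ[𝓝 x] (extend E (Y.1 x) : Π y : M, TangentSpace I y) :=
    toFieldsOn_eventuallyEq ht _ hxt
  have ext_apply (Y) (hY : t ⊆ u Y) : (ext Y hY).1 x = (res Y).1 x := by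
    rw [(ext_eq Y hY).eq_of_nhds, (res_eq Y).eq_of_nhds, extend_apply_self]
  have hU : t ⊆ u U := fun y hy ↦ (htu hy).2.1
  have hV : t ⊆ u V := fun y hy ↦ (htu hy).2.2.1
  have hW : t ⊆ u W := fun y hy ↦ (htu hy).2.2.2
  calc riemannTensor x (U.1 x) (V.1 x) (W.1 x)
      = curvature (ext U hU).1 (ext V hV).1 (ext W hW).1 x :=
        (curvature_congr (ext_eq U hU) (ext_eq V hV) (ext_eq W hW)).symm
    _ = curvature (res U).1 (res V).1 (res W).1 x :=
        hf.isParsevalFrame.curvature_apply_congr (ext_apply U hU) (ext_apply V hV) (ext_apply W hW)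
    _ = curvature U.1 V.1 W.1 x := curvature_congr (res_eq U) (res_eq V) (res_eq W)

theorem ricci_apply (hs : IsOpen s) (he : IsOrthonormalFrame e) (hx : x ∈ s)
    (U V : fieldsOn I s) :
    ricci x (U.1 x) (V.1 x) = ((leviCivitaOn I s).ric e U V).1 x := by
  obtain ⟨e', he', he'x⟩ := he.exists_isParsevalFrame_eq_onb hx
  rw [(leviCivitaOn I s).ric_eq he.isParsevalFrame he', LeviCivitaStructure.ric_apply,
    frameTrace_apply, smoothOn.sum_apply]
  refine Finset.sum_congr rfl fun i _ ↦ ?_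
  rw [← he'x i, riemannTensor_apply hs hx]
  rfl

theorem scalarCurvature_apply (hs : IsOpen s) (he : IsOrthonormalFrame e) (hx : x ∈ s) :
    scalarCurvature I x = ((leviCivitaOn I s).scalar e).1 x := by
  obtain ⟨e', he', he'x⟩ := he.exists_isParsevalFrame_eq_onb hx
  rw [(leviCivitaOn I s).scalar_eq he.isParsevalFrame he', LeviCivitaStructure.scalar,
    frameTrace_apply, smoothOn.sum_apply]
  refine Finset.sum_congr rfl fun i _ ↦ ?_
  rw [← he'x i, ricci_apply hs he hx,
    (leviCivitaOn I s).ric_eq he.isParsevalFrame he']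

theorem normSq_ricci (hs : IsOpen s) (he : IsOrthonormalFrame e) (hx : x ∈ s) :
    normSq (fun u v : TangentSpace I x ↦ ricci x u v)
      = (frameContract e ((leviCivitaOn I s).ric e) ((leviCivitaOn I s).ric e)).1 x := by
  obtain ⟨e', he', he'x⟩ := he.exists_isParsevalFrame_eq_onb hx
  rw [he.isParsevalFrame.frameContract_eq he' (leviCivitaOn I s).metric_comm, frameContract,
    smoothOn.sum_apply]
  refine Finset.sum_congr rfl fun i _ ↦ ?_
  rw [smoothOn.sum_apply]
  refine Finset.sum_congr rfl fun j _ ↦ ?_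
  beta_reduce
  rw [← he'x i, ← he'x j, ricci_apply hs he hx, sq]
  rfl

theorem gradient_apply (hs : IsOpen s) (he : IsOrthonormalFrame e) (hx : x ∈ s) {f : M → ℝ}
    {F : smoothOn I s} (hF : Set.EqOn f F.1 s) :
    gradient I f x = (∑ i, differential F (e i) • e i).1 x := by
  obtain ⟨e', he', he'x⟩ := he.exists_isParsevalFrame_eq_onb hx
  rw [he.isParsevalFrame.sum_smul_eq he' (leviCivitaOn I s).metric_comm, fieldsOn.sum_apply]
  refine Finset.sum_congr rfl fun i _ ↦ ?_
  rw [← he'x i, mvfderiv_congr (hF.eventuallyEq_of_mem (hs.mem_nhds hx))]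
  rfl

theorem laplacian_apply (hs : IsOpen s) (he : IsOrthonormalFrame e) (hx : x ∈ s) {f : M → ℝ}
    {F : smoothOn I s} (hF : Set.EqOn f F.1 s) :
    laplacian I f x = ((leviCivitaOn I s).divOneForm e (differential F)).1 x := by
  obtain ⟨e', he', he'x⟩ := he.exists_isParsevalFrame_eq_onb hx
  have grad_eq : gradient I f =ᶠ[𝓝 x] (∑ i, differential F (e i) • e i).1 :=
    Filter.eventually_of_mem (hs.mem_nhds hx) fun y hy ↦ gradient_apply hs he hy hF
  rw [(leviCivitaOn I s).divOneForm_eq he.isParsevalFrame he',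
    ← he.isParsevalFrame.apply_sum_smul (leviCivitaOn I s).metric_comm (differential F),
    LeviCivitaStructure.divOneForm_apply, frameTrace_apply, smoothOn.sum_apply, laplacian,
    divergence]
  refine Finset.sum_congr rfl fun i _ ↦ ?_
  rw [LeviCivitaStructure.covOneForm_metric, leviCivita_congr grad_eq, ← he'x i]
  rfl

theorem lieDerivMetric_eq {X : Π x : M, TangentSpace I x} (hX : MDiffAt (T% X) x)
    (u v : TangentSpace I x) : lieDerivMetric X x u v
      = inner ℝ (leviCivita I M X x u) v + inner ℝ (leviCivita I M X x v) u := by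
  have hu := mdifferentiableAt_extend I E u
  have hv := mdifferentiableAt_extend I E v
  rw [lieDerivMetric, leviCivita_metric hX hu hv, ← leviCivita_sub_leviCivita hX hu,
    ← leviCivita_sub_leviCivita hX hv]
  simp only [extend_apply_self, inner_sub_left, inner_sub_right]
  rw [real_inner_comm u (leviCivita I M X x v)]
  ring

theorem contMDiff_scalarCurvature : ContMDiff I 𝓘(ℝ, ℝ) ∞ (scalarCurvature I : M → ℝ) := by
  intro x
  obtain ⟨s, -, hs, hx, e, he⟩ := exists_isOrthonormalFrame (I := I) (x := x) Filter.univ_mem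
  exact (((leviCivitaOn I s).scalar e).2 x hx).congr_of_eventuallyEq <|
    Filter.eventually_of_mem (hs.mem_nhds hx) fun y hy ↦ scalarCurvature_apply hs he hy

theorem IsRicciSoliton.isSoliton {X : Π x : M, TangentSpace I x} {lam : ℝ}
    (hX : IsRicciSoliton X lam) (hs : IsOpen s) (he : IsOrthonormalFrame e) :
    (leviCivitaOn I s).IsSoliton e (toFieldsOn hs X fun y _ ↦ hX.contMDiff y)
      (algebraMap ℝ (smoothOn I s) lam) where
  lie_const U := by
    ext y
    change mvfderiv I (fun _ : M ↦ lam) y (U.1 y) = 0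
    rw [mvfderiv_const, zero_apply]
  eq := by
    ext U V y
    set X' : fieldsOn I s := toFieldsOn hs X fun y _ ↦ hX.contMDiff y
    change 2 • ((leviCivitaOn I s).ric e U V).1 y + ((leviCivitaOn I s).lieMetric X' U V).1 y
      = 2 • (lam * inner ℝ (U.1 y) (V.1 y))
    rw [LeviCivitaStructure.lieMetric_apply]
    change 2 • ((leviCivitaOn I s).ric e U V).1 y + (inner ℝ (leviCivita I M X'.1 y (U.1 y)) (V.1 y)
      + inner ℝ (leviCivita I M X'.1 y (V.1 y)) (U.1 y)) = 2 • (lam * inner ℝ (U.1 y) (V.1 y))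
    by_cases hy : y ∈ s
    · have soliton := hX.eq y (U.1 y) (V.1 y)
      rw [lieDerivMetric_eq ((hX.contMDiff y).mdifferentiableAt (by simp)),
        ricci_apply hs he hy] at soliton
      rw [leviCivita_congr (toFieldsOn_eventuallyEq (V := X) hs _ hy), two_nsmul, two_nsmul]
      linarith
    · have ric_eq_zero : ((leviCivitaOn I s).ric e U V).1 y = 0 := by
        rw [LeviCivitaStructure.ric_apply, frameTrace_apply, smoothOn.sum_apply]
        exact Finset.sum_eq_zero fun i _ ↦
          (congrArg (inner ℝ _) ((e i).2.2 y hy)).trans (inner_zero_right _)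
      simp [ric_eq_zero, U.2.2 y hy, V.2.2 y hy]

theorem IsRicciSoliton.laplacian_scalarCurvature {X : Π x : M, TangentSpace I x} {lam : ℝ}
    (hX : IsRicciSoliton X lam) (x : M) :
    1 / 2 * laplacian I (scalarCurvature I) x
      = 1 / 2 * inner ℝ (gradient I (scalarCurvature I) x) (X x) + lam * scalarCurvature I x
        - normSq (fun u v : TangentSpace I x ↦ ricci x u v) := by
  obtain ⟨s, -, hs, hx, e, he⟩ := exists_isOrthonormalFrame (I := I) (x := x) Filter.univ_mem
  have hS : Set.EqOn (scalarCurvature I) ((leviCivitaOn I s).scalar e).1 s :=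
    fun y hy ↦ scalarCurvature_apply hs he hy
  have gradient_eq : inner ℝ (gradient I (scalarCurvature I) x) (X x)
      = (⁅toFieldsOn hs X fun y _ ↦ hX.contMDiff y, (leviCivitaOn I s).scalar e⁆).1 x := by
    rw [inner_gradient, mvfderiv_congr (hS.eventuallyEq_of_mem (hs.mem_nhds hx)),
      fieldsOn.lie_smoothOn_apply, toFieldsOn_apply hs _ hx]
  have h : _ = _ + 2 * lam * ((leviCivitaOn I s).scalar e).1 x - 2 * _ :=
    congrArg (·.1 x) ((hX.isSoliton hs he).laplacian_scalar he.isParsevalFrame)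
  rw [← laplacian_apply hs he hx hS, ← gradient_eq, ← hS hx, ← normSq_ricci hs he hx] at h
  linarith

end Geometry

end Riem

theorem mainTheorem9_general {E : Type*} [NormedAddCommGroup E] [NormedSpace ℝ E]
    [FiniteDimensional ℝ E]
    {H : Type*} [TopologicalSpace H] {I : ModelWithCorners ℝ E H}
    {M : Type*} [TopologicalSpace M] [ChartedSpace H M] [IsManifold I ∞ M]
    [RiemannianBundle (fun x : M ↦ TangentSpace I x)]
    [IsContMDiffRiemannianBundle I ∞ E (fun x : M ↦ TangentSpace I x)]
    (m : ℕ) (hm : Module.finrank ℝ E = m)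
    (X : Π x : M, TangentSpace I x) (lam : ℝ) (hX : Riem.IsRicciSoliton X lam) :
    ContMDiff I 𝓘(ℝ, ℝ) ∞ (Riem.scalarCurvature I : M → ℝ) ∧
    ∀ x : M,
      1 / 2 * Riem.laplacian I (Riem.scalarCurvature I) x
        = 1 / 2 * inner ℝ (Riem.gradient I (Riem.scalarCurvature I) x) (X x)
          + lam * Riem.scalarCurvature I x
          - Riem.normSq (fun u v : TangentSpace I x ↦ Riem.ricci x u v) ∧
      1 / 2 * Riem.laplacian I (Riem.scalarCurvature I) x
        = 1 / 2 * inner ℝ (Riem.gradient I (Riem.scalarCurvature I) x) (X x)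
          + lam * Riem.scalarCurvature I x
          - Riem.scalarCurvature I x ^ 2 / m
          - Riem.normSq (fun u v : TangentSpace I x ↦
              Riem.ricci x u v - Riem.scalarCurvature I x / m * inner ℝ u v) := by
  refine ⟨Riem.contMDiff_scalarCurvature, fun x ↦ ⟨hX.laplacian_scalarCurvature x, ?_⟩⟩
  have h := Riem.normSq_sub_trace (fun u v : TangentSpace I x ↦ Riem.ricci x u v) hm
  rw [hX.laplacian_scalarCurvature x, ← h]
  simp only [Riem.scalarCurvature]
  ring

theorem mainTheorem9 {E : Type*} [NormedAddCommGroup E] [NormedSpace ℝ E] [FiniteDimensional ℝ E]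
    {H : Type*} [TopologicalSpace H] {I : ModelWithCorners ℝ E H} [I.Boundaryless]
    {M : Type*} [TopologicalSpace M] [ChartedSpace H M] [IsManifold I ∞ M]
    [RiemannianBundle (fun x : M ↦ TangentSpace I x)]
    [IsContMDiffRiemannianBundle I ∞ E (fun x : M ↦ TangentSpace I x)]
    (m : ℕ) (hm : Module.finrank ℝ E = m)
    (X : Π x : M, TangentSpace I x) (lam : ℝ) (hX : Riem.IsRicciSoliton X lam) :
    ContMDiff I 𝓘(ℝ, ℝ) ∞ (Riem.scalarCurvature I : M → ℝ) ∧
    ∀ x : M,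
      1 / 2 * Riem.laplacian I (Riem.scalarCurvature I) x
        = 1 / 2 * inner ℝ (Riem.gradient I (Riem.scalarCurvature I) x) (X x)
          + lam * Riem.scalarCurvature I x
          - Riem.normSq (fun u v : TangentSpace I x ↦ Riem.ricci x u v) ∧
      1 / 2 * Riem.laplacian I (Riem.scalarCurvature I) x
        = 1 / 2 * inner ℝ (Riem.gradient I (Riem.scalarCurvature I) x) (X x)
          + lam * Riem.scalarCurvature I x
          - Riem.scalarCurvature I x ^ 2 / m
          - Riem.normSq (fun u v : TangentSpace I x ↦
              Riem.ricci x u v - Riem.scalarCurvature I x / m * inner ℝ u v) :=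
  mainTheorem9_general m hm X lam hX
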